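/- Let $\mathscr{H}_1$ be a complex Hilbert space of finite dimension $k$ and let $\rho_1$ be a density matrix on $\mathscr{H}_1$ (a positive operator with trace $1$), with an orthonormal eigenbasis $\chi_1,\dots,\chi_k$ and eigenvalues $p_1,\dots,p_k$. Write $\mathbb{S}(\cdot)$ for the unit sphere of a Hilbert space. The measure $GAP(\rho_1)$ on $\mathbb{S}(\mathscr{H}_1)$ is defined as follows. Let $G(\rho_1)$ be the law of $\sum_i Z_i\chi_i$, where the $Z_i$ are independent complex random variables such that $\mathrm{Re}\,Z_i$ and $\mathrm{Im}\,Z_i$ are independent real Gaussians with mean $0$ and variance $p_i/2$; let $GA(\rho_1)(d\psi)=\|\psi\|^2\,G(\rho_1)(d\psi)$; and let $GAP(\rho_1)$ be the image of $GA(\rho_1)$ under $\psi\mapsto\psi/\|\psi\|$. Let $\mathscr{H}_2$ be a complex Hilbert space of finite dimension $m\ge k$. For $\psi\in\mathscr{H}_1\otimes\mathscr{H}_2$ let $\rho_1^{\mathrm{red}}(\psi)=\mathrm{tr}_2|\psi\rangle\langle\psi|$, and let $\mathscr{R}(\rho_1)=\{\psi\in\mathbb{S}(\mathscr{H}_1\otimes\mathscr{H}_2):\rho_1^{\mathrm{red}}(\psi)=\rho_1\}$.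 The uniform distribution $u_{\rho_1}$ on $\mathscr{R}(\rho_1)$ is the law of $\sum_{i=1}^k\sqrt{p_i}\,\chi_i\otimes\phi_i$, where $(\phi_1,\dots,\phi_k)$ is a uniformly distributed orthonormal system in $\mathscr{H}_2$, that is, $\phi_i=Ue_i$ with $e_1,\dots,e_m$ a fixed orthonormal basis of $\mathscr{H}_2$ and $U$ distributed according to the normalized Haar measure on the unitary group of $\mathscr{H}_2$. For an orthonormal basis $\{|q_2\rangle\}$ of $\mathscr{H}_2$ and $\psi\in\mathbb{S}(\mathscr{H}_1\otimes\mathscr{H}_2)$, let $\langle q_2|\psi\rangle\in\mathscr{H}_1$ be the partial scalar product, and let $$\mu_1^\psi=\sum_{q_2:\ \langle q_2|\psi\rangle\neq 0}\bigl\|\langle q_2|\psi\rangle\bigr\|^2\;\delta_{\langle q_2|\psi\rangle/\|\langle q_2|\psi\rangle\|}$$ be the distribution on $\mathbb{S}(\mathscr{H}_1)$ of the conditional wave function of system 1. For a measure $\mu$ on $\mathbb{S}(\mathscr{H}_1)$ write $\mu(f)=\int f\,d\mu$. Then for every $\varepsilon>0$ and every bounded continuous $f:\mathbb{S}(\mathscr{H}_1)\to\mathbb{R}$,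 $$u_{\rho_1}\Bigl\{\psi\in\mathscr{R}(\rho_1):\bigl|\mu_1^\psi(f)-GAP(\rho_1)(f)\bigr|<\varepsilon\Bigr\}\longrightarrow 1\qquad\text{as } m=\dim\mathscr{H}_2\to\infty,$$ regardless of how the basis $\{|q_2\rangle\}$ is chosen: the convergence holds along every sequence of spaces $\mathscr{H}_2$ with $\dim\mathscr{H}_2\ge k$ and $\dim\mathscr{H}_2\to\infty$, and for every choice of an orthonormal basis of each of them. -/

import Mathlib

open Filter Topology MeasureTheory ProbabilityTheory
open scoped TensorProduct BoundedContinuousFunction ENNReal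

noncomputable section

namespace GAPMeasure

universe u v

variable {H : Type u} [NormedAddCommGroup H] [InnerProductSpace ℂ H]
variable {H₁ : Type u} [NormedAddCommGroup H₁] [InnerProductSpace ℂ H₁]
variable {H₂ : Type v} [NormedAddCommGroup H₂] [InnerProductSpace ℂ H₂]

/-- The Borel `σ`-algebra on the Hilbert space `H₁ ⊗ H₂`. -/
instance tensorMeasurableSpace : MeasurableSpace (H₁ ⊗[ℂ] H₂) := borel _

instance tensorBorelSpace : BorelSpace (H₁ ⊗[ℂ] H₂) := ⟨rfl⟩

/-- The unit sphere of a Hilbert space. -/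
abbrev UnitSphere (H : Type u) [NormedAddCommGroup H] : Type u := Metric.sphere (0 : H) 1

/-- `P : H ∖ {0} → S(H)`, `P ψ = ‖ψ‖⁻¹ ψ`. -/
def normalize (ψ : {ψ : H // ψ ≠ 0}) : UnitSphere H :=
  ⟨((‖(ψ : H)‖⁻¹ : ℝ) : ℂ) • (ψ : H), by
    have h : ‖(ψ : H)‖ ≠ 0 := norm_ne_zero_iff.mpr ψ.2
    simp [norm_smul, h]⟩

/-! ### Density matrices and the measures `G(ρ)`, `GA(ρ)`, `GAP(ρ)` -/

/-- A density matrix: a positive operator with trace `1`. -/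
structure IsDensityMatrix (ρ : H →ₗ[ℂ] H) : Prop where
  isPositive : ρ.IsPositive
  trace_eq_one : LinearMap.trace ℂ H ρ = 1

section GAP

variable [FiniteDimensional ℂ H] [MeasurableSpace H]

/-- The law of a rotationally symmetric complex Gaussian `Z` with mean `0` and `𝔼|Z|² = p`
(for `p ≥ 0`): real and imaginary part are independent centred real Gaussians with
variance `p / 2`. -/
def complexGaussian (p : ℝ) : Measure ℂ :=
  ((gaussianReal 0 (p / 2).toNNReal).prod (gaussianReal 0 (p / 2).toNNReal)).map
    (fun x : ℝ × ℝ => (x.1 : ℂ) + (x.2 : ℂ) * Complex.I)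

/-- `G(ρ)`: the law of `∑ n, Z n • |n⟩`, where `|n⟩` is an orthonormal eigenbasis of `ρ` with
eigenvalues `p n`, and the `Z n` are independent complex Gaussians with `𝔼|Z n|² = p n`. -/
def gaussian {ρ : H →ₗ[ℂ] H} (hρ : IsDensityMatrix ρ) : Measure H :=
  (Measure.pi (fun n : Fin (Module.finrank ℂ H) =>
      complexGaussian (hρ.isPositive.isSymmetric.eigenvalues rfl n))).map
    (fun z => ∑ n, z n • hρ.isPositive.isSymmetric.eigenvectorBasis rfl n)

/-- `GA(ρ)(dψ) = ‖ψ‖² G(ρ)(dψ)`. -/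
def adjustedGaussian {ρ : H →ₗ[ℂ] H} (hρ : IsDensityMatrix ρ) : Measure H :=
  (gaussian hρ).withDensity (fun ψ => ENNReal.ofReal (‖ψ‖ ^ 2))

/-- `GAP(ρ) = P_* GA(ρ)`, where `GA(ρ)`, which gives no mass to `{0}`, is regarded as a measure
on `H ∖ {0}`. -/
def gap {ρ : H →ₗ[ℂ] H} (hρ : IsDensityMatrix ρ) : Measure (UnitSphere H) :=
  ((adjustedGaussian hρ).comap (Subtype.val : {ψ : H // ψ ≠ 0} → H)).map normalize

end GAP

/-! ### The conditional wave function -/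

/-- The partial scalar product `⟨q|ψ⟩ ∈ H₁` of `q ∈ H₂` and `ψ ∈ H₁ ⊗ H₂`; it sends
`x ⊗ y` to `⟨q|y⟩ x`. -/
def partialInner (q : H₂) : H₁ ⊗[ℂ] H₂ →ₗ[ℂ] H₁ :=
  (TensorProduct.rid ℂ H₁).toLinearMap ∘ₗ
    LinearMap.lTensor H₁ (innerSL ℂ q : H₂ →L[ℂ] ℂ).toLinearMap

open Classical in
/-- The distribution `μ₁^ψ` of the conditional wave function of system 1, for the orthonormal
basis `b` of `H₂`: the sum over `q` of `‖⟨q|ψ⟩‖²` times the unit mass at `⟨q|ψ⟩ / ‖⟨q|ψ⟩‖`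
(where `q` with `⟨q|ψ⟩ = 0` does not contribute). -/
def conditionalLaw [MeasurableSpace H₁] {ι : Type*} [Fintype ι] (b : OrthonormalBasis ι ℂ H₂)
    (ψ : H₁ ⊗[ℂ] H₂) : Measure (UnitSphere H₁) :=
  ∑ q, if h : partialInner (b q) ψ = 0 then 0 else
    ENNReal.ofReal (‖partialInner (b q) ψ‖ ^ 2) •
      Measure.dirac (normalize ⟨partialInner (b q) ψ, h⟩)

/-! ### Reduced density matrices -/

section Reduced

variable [FiniteDimensional ℂ H₁] [FiniteDimensional ℂ H₂]

/-- The partial trace `tr₂ : End(H₁ ⊗ H₂) → End(H₁)`; it sends `A ⊗ B` to `tr(B) A`. -/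
def partialTrace : (H₁ ⊗[ℂ] H₂ →ₗ[ℂ] H₁ ⊗[ℂ] H₂) →ₗ[ℂ] (H₁ →ₗ[ℂ] H₁) :=
  (TensorProduct.rid ℂ (H₁ →ₗ[ℂ] H₁)).toLinearMap ∘ₗ
    LinearMap.lTensor (H₁ →ₗ[ℂ] H₁) (LinearMap.trace ℂ H₂) ∘ₗ
      (homTensorHomEquiv ℂ H₁ H₂ H₁ H₂).symm.toLinearMap

/-- `tr₂ |ψ⟩⟨ψ|`. -/
def reducedDensity (ψ : H₁ ⊗[ℂ] H₂) : H₁ →ₗ[ℂ] H₁ :=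
  partialTrace (InnerProductSpace.rankOne ℂ ψ ψ).toLinearMap

/-- `R(ρ₁)`: the unit vectors of `H₁ ⊗ H₂` with reduced density matrix `ρ₁`. -/
def withReduced (ρ₁ : H₁ →ₗ[ℂ] H₁) : Set (H₁ ⊗[ℂ] H₂) :=
  {ψ | ‖ψ‖ = 1 ∧ reducedDensity ψ = ρ₁}

end Reduced

/-! ### The uniform distributions -/

section Uniform

variable [FiniteDimensional ℂ H₂] [CompleteSpace H₂]

instance unitaryCompactSpace : CompactSpace (unitary (H₂ →L[ℂ] H₂)) := by
  have : ProperSpace (H₂ →L[ℂ] H₂) := FiniteDimensional.proper ℂ _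
  refine isCompact_iff_compactSpace.mp (Metric.isCompact_of_isClosed_isBounded ?_ ?_)
  · exact isClosed_unitary
  · refine (Metric.isBounded_closedBall (x := (0 : H₂ →L[ℂ] H₂)) (r := 1)).subset ?_
    intro U hU
    rw [mem_closedBall_zero_iff]
    refine ContinuousLinearMap.opNorm_le_bound _ zero_le_one fun x => ?_
    rw [one_mul, (ContinuousLinearMap.norm_map_iff_adjoint_comp_self U).mpr
      (Unitary.star_mul_self_of_mem hU) x]

/-- The normalized Haar measure on the unitary group of `H₂`. -/
def unitaryHaar (H₂ : Type v) [NormedAddCommGroup H₂] [InnerProductSpace ℂ H₂]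
    [FiniteDimensional ℂ H₂] [CompleteSpace H₂] : Measure (unitary (H₂ →L[ℂ] H₂)) :=
  Measure.haarMeasure ⊤

/-- The uniform distribution on the orthonormal systems `(φ i)` of cardinality `k ≤ dim H₂`: the
law of the first `k` vectors of the uniformly distributed orthonormal basis `(U eⱼ)`, for Haar
distributed `U` and a fixed orthonormal basis `(eⱼ)` of `H₂`. -/
def uniformONS [MeasurableSpace H₂] {k : ℕ} (hk : k ≤ Module.finrank ℂ H₂) :
    Measure (Fin k → H₂) :=
  (unitaryHaar H₂).map
    (fun (U : unitary (H₂ →L[ℂ] H₂)) i =>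
      (U : H₂ →L[ℂ] H₂) (stdOrthonormalBasis ℂ H₂ (Fin.castLE hk i)))

/-- The uniform distribution `u_{ρ₁}` on `R(ρ₁)`: the law of `∑ i, cᵢ χᵢ ⊗ φᵢ`, where `(χᵢ)` is
an orthonormal eigenbasis of `ρ₁` with eigenvalues `cᵢ²`, `cᵢ ≥ 0`, and `(φᵢ)` is a uniformly
distributed orthonormal system in `H₂`. -/
def uniformWithReduced [FiniteDimensional ℂ H₁] [MeasurableSpace H₂]
    {ρ₁ : H₁ →ₗ[ℂ] H₁} (hρ₁ : IsDensityMatrix ρ₁)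
    (hdim : Module.finrank ℂ H₁ ≤ Module.finrank ℂ H₂) : Measure (H₁ ⊗[ℂ] H₂) :=
  (uniformONS (H₂ := H₂) hdim).map
    (fun φ => ∑ i, ((√(hρ₁.isPositive.isSymmetric.eigenvalues rfl i) : ℝ) : ℂ) •
      (hρ₁.isPositive.isSymmetric.eigenvectorBasis rfl i ⊗ₜ[ℂ] φ i))

end Uniform

end GAPMeasure

end

/-! Extend `f` to a function `F` on `H₁` that is homogeneous of degree 2 (`homogExtend`). Weighting
by squared norms is built into both measures, so `μ₁^ψ(f) = ∑ q, F ⟨q|ψ⟩` and `GAP(ρ₁)(f) = 𝔼 F(T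
Z)`, where `Z` is standard complex Gaussian in `ℂ^k` and `T = sqrtMap` scales its coordinates by
`√pᵢ`. For `ψ = ∑ √pᵢ χᵢ ⊗ φᵢ` the conditional vector `⟨q|ψ⟩` is `T` applied to the row `(⟨q|φᵢ⟩)ᵢ`.

Replace the `φᵢ` by Gaussian vectors `gᵢ` whose coordinates in the given basis are `m^(-1/2)` times
independent standard Gaussians. By homogeneity the sum becomes an average of `m` independent copies
of `F(T Z)`, and the strong law gives the limit. The strong law also sends the Gram matrix of `g` to
the identity, so Gram–Schmidt moves each `gᵢ` by `o(1)` in norm (`tendsto_gramSchmidtNormed_sub`). A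
quadratic modulus of continuity for `F` together with Parseval shows that the sum then changes by
`o(1)` (`tendsto_sum_homogExtend_sub`).

The Gaussian family has a unitarily invariant law, so its orthonormalization is governed by the Haar
measure (`measure_gramSchmidtNormed_le_uniformONS`). This holds for coordinates in any orthonormal
basis, hence the freedom in choosing it. Only the law for each single `n` matters, so one Gaussian
sequence can drive all the spaces at once, and almost sure convergence yields the claim. -/

namespace GAPMeasure

open InnerProductSpace

/-! ### Convergence of norms in spaces that vary with the index -/

section Norms

variable {α : Type*} {l : Filter α} {E : α → Type*} [∀ a, NormedAddCommGroup (E a)]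

theorem tendsto_norm_one_of_inner_self [∀ a, InnerProductSpace ℂ (E a)] {x : ∀ a, E a}
    (hx : Tendsto (fun a => inner ℂ (x a) (x a)) l (𝓝 1)) :
    Tendsto (fun a => ‖x a‖) l (𝓝 1) := by
  have h := (Real.continuous_sqrt.tendsto _).comp ((Complex.continuous_re.tendsto _).comp hx)
  simp only [Complex.one_re, Real.sqrt_one] at h
  exact h.congr fun a => (norm_eq_sqrt_re_inner (𝕜 := ℂ) (x a)).symm

theorem tendsto_norm_of_tendsto_norm_sub {x y : ∀ a, E a} {c : ℝ}
    (h : Tendsto (fun a => ‖x a - y a‖) l (𝓝 0)) (hy : Tendsto (fun a => ‖y a‖) l (𝓝 c)) :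
    Tendsto (fun a => ‖x a‖) l (𝓝 c) := by
  have h0 : Tendsto (fun a => ‖x a‖ - ‖y a‖) l (𝓝 0) :=
    squeeze_zero_norm (fun a => abs_norm_sub_norm_le (x a) (y a)) h
  simpa using h0.add hy

end Norms

/-! ### Gram–Schmidt: equivariance, measurability, stability -/

section GramSchmidt

variable {κ : Type*} [LinearOrder κ] [LocallyFiniteOrderBot κ] [WellFoundedLT κ]

/-- The Gram–Schmidt process commutes with linear isometries. -/
theorem gramSchmidt_map {E F : Type*} [NormedAddCommGroup E] [InnerProductSpace ℂ E]
    [NormedAddCommGroup F] [InnerProductSpace ℂ F] (V : E →ₗᵢ[ℂ] F) (g : κ → E) (i : κ) :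
    gramSchmidt ℂ (fun j => V (g j)) i = V (gramSchmidt ℂ g i) := by
  induction i using WellFoundedLT.induction with
  | ind i ih =>
    rw [gramSchmidt_def, gramSchmidt_def, map_sub, map_sum]
    congr 1
    refine Finset.sum_congr rfl fun j hj => ?_
    rw [ih j (Finset.mem_Iio.mp hj), Submodule.starProjection_singleton,
      Submodule.starProjection_singleton, V.inner_map_map, V.norm_map, map_smul]

theorem gramSchmidtNormed_map {E F : Type*} [NormedAddCommGroup E] [InnerProductSpace ℂ E]
    [NormedAddCommGroup F] [InnerProductSpace ℂ F] (V : E →ₗᵢ[ℂ] F) (g : κ → E) (i : κ) :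
    gramSchmidtNormed ℂ (fun j => V (g j)) i = V (gramSchmidtNormed ℂ g i) := by
  simp only [gramSchmidtNormed, gramSchmidt_map, V.norm_map, map_smul]

theorem measurable_gramSchmidt {E : Type*} [NormedAddCommGroup E] [InnerProductSpace ℂ E]
    [FiniteDimensional ℂ E] [MeasurableSpace E] [BorelSpace E] (i : κ) :
    Measurable fun g : κ → E => gramSchmidt ℂ g i := by
  have : ProperSpace E := FiniteDimensional.proper ℂ E
  induction i using WellFoundedLT.induction with
  | ind i ih =>
    simp_rw [gramSchmidt_def _ _ i, Submodule.starProjection_singleton]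
    refine (measurable_pi_apply i).sub (Finset.measurable_sum _ fun j hj => ?_)
    have h := ih j (Finset.mem_Iio.mp hj)
    refine Measurable.smul (Measurable.div (h.inner (measurable_pi_apply i)) ?_) h
    exact Complex.measurable_ofReal.comp (h.norm.pow_const 2)

theorem measurable_gramSchmidtNormed {E : Type*} [NormedAddCommGroup E] [InnerProductSpace ℂ E]
    [FiniteDimensional ℂ E] [MeasurableSpace E] [BorelSpace E] :
    Measurable fun g : κ → E => gramSchmidtNormed ℂ g := by
  have : ProperSpace E := FiniteDimensional.proper ℂ E
  refine measurable_pi_lambda _ fun i => ?_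
  have h := measurable_gramSchmidt (E := E) i
  exact (Complex.measurable_ofReal.comp h.norm).inv.smul h

variable {α : Type*} {l : Filter α} {E : α → Type*} [∀ a, NormedAddCommGroup (E a)]
  [∀ a, InnerProductSpace ℂ (E a)] {g : ∀ a, κ → E a}

/-- The Gram–Schmidt process hardly changes an almost orthonormal family. -/
theorem tendsto_gramSchmidt_sub
    (hg : ∀ i, Tendsto (fun a => inner ℂ (g a i) (g a i)) l (𝓝 1))
    (hg' : ∀ i j, i ≠ j → Tendsto (fun a => inner ℂ (g a i) (g a j)) l (𝓝 0)) (i : κ) :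
    Tendsto (fun a => ‖gramSchmidt ℂ (g a) i - g a i‖) l (𝓝 0) := by
  induction i using WellFoundedLT.induction with
  | ind i ih =>
    have hn := tendsto_norm_one_of_inner_self (hg i)
    -- The fraction bounds the length of the projection of `g a i` onto the `j`-th Gram–Schmidt
    -- vector; by induction its numerator tends to 0 and its denominator to 1.
    have key : ∀ j ∈ Finset.Iio i, Tendsto
        (fun a => (‖gramSchmidt ℂ (g a) j - g a j‖ * ‖g a i‖ + ‖inner ℂ (g a j) (g a i)‖) /
          ‖gramSchmidt ℂ (g a) j‖) l (𝓝 0) := by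
      intro j hj
      have hj' := Finset.mem_Iio.mp hj
      have h1 := tendsto_norm_of_tendsto_norm_sub (ih j hj') (tendsto_norm_one_of_inner_self (hg j))
      have h2 := (((ih j hj').mul hn).add (hg' j i hj'.ne).norm).div h1 one_ne_zero
      simp only [zero_mul, norm_zero, add_zero, zero_div] at h2
      exact h2
    have hs := tendsto_finsetSum _ key
    simp only [Finset.sum_const_zero] at hs
    refine squeeze_zero (fun a => norm_nonneg _) (fun a => ?_) hs
    rw [gramSchmidt_def, sub_sub_cancel_left, norm_neg]
    refine (norm_sum_le _ _).trans (Finset.sum_le_sum fun j _ => ?_)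
    rw [Submodule.starProjection_singleton, norm_smul, norm_div]
    have h3 : ‖inner ℂ (gramSchmidt ℂ (g a) j) (g a i)‖ ≤
        ‖gramSchmidt ℂ (g a) j - g a j‖ * ‖g a i‖ + ‖inner ℂ (g a j) (g a i)‖ := by
      have h4 : inner ℂ (gramSchmidt ℂ (g a) j) (g a i) =
          inner ℂ (gramSchmidt ℂ (g a) j - g a j) (g a i) + inner ℂ (g a j) (g a i) := by
        rw [inner_sub_left, sub_add_cancel]
      rw [h4]
      exact (norm_add_le _ _).trans (add_le_add_left (norm_inner_le_norm _ _) _)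
    -- If the vector vanishes, both sides are 0 by the convention for division by zero.
    by_cases h0 : ‖gramSchmidt ℂ (g a) j‖ = 0
    · simp [h0]
    · have h5 : 0 < ‖gramSchmidt ℂ (g a) j‖ := lt_of_le_of_ne (norm_nonneg _) (Ne.symm h0)
      have h6 : ‖((‖gramSchmidt ℂ (g a) j‖ ^ 2 : ℝ) : ℂ)‖ = ‖gramSchmidt ℂ (g a) j‖ ^ 2 := by
        rw [Complex.norm_real, Real.norm_of_nonneg (by positivity)]
      have h7 : ‖inner ℂ (gramSchmidt ℂ (g a) j) (g a i)‖ / ‖gramSchmidt ℂ (g a) j‖ ^ 2 *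
          ‖gramSchmidt ℂ (g a) j‖ =
          ‖inner ℂ (gramSchmidt ℂ (g a) j) (g a i)‖ / ‖gramSchmidt ℂ (g a) j‖ := by
        field_simp
      erw [h6]
      rw [h7]
      gcongr

theorem tendsto_norm_gramSchmidt
    (hg : ∀ i, Tendsto (fun a => inner ℂ (g a i) (g a i)) l (𝓝 1))
    (hg' : ∀ i j, i ≠ j → Tendsto (fun a => inner ℂ (g a i) (g a j)) l (𝓝 0)) (i : κ) :
    Tendsto (fun a => ‖gramSchmidt ℂ (g a) i‖) l (𝓝 1) :=
  tendsto_norm_of_tendsto_norm_sub (tendsto_gramSchmidt_sub hg hg' i)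
    (tendsto_norm_one_of_inner_self (hg i))

theorem tendsto_gramSchmidtNormed_sub
    (hg : ∀ i, Tendsto (fun a => inner ℂ (g a i) (g a i)) l (𝓝 1))
    (hg' : ∀ i j, i ≠ j → Tendsto (fun a => inner ℂ (g a i) (g a j)) l (𝓝 0)) (i : κ) :
    Tendsto (fun a => ‖gramSchmidtNormed ℂ (g a) i - g a i‖) l (𝓝 0) := by
  have h1 := tendsto_norm_gramSchmidt hg hg' i
  have h2 : Tendsto (fun a => |‖gramSchmidt ℂ (g a) i‖⁻¹ - 1| * ‖gramSchmidt ℂ (g a) i‖ +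
      ‖gramSchmidt ℂ (g a) i - g a i‖) l (𝓝 0) := by
    have := ((((h1.inv₀ one_ne_zero).sub_const 1).abs).mul h1).add
      (tendsto_gramSchmidt_sub hg hg' i)
    simpa using this
  refine squeeze_zero (fun a => norm_nonneg _) (fun a => ?_) h2
  refine (norm_sub_le_norm_sub_add_norm_sub _ (gramSchmidt ℂ (g a) i) _).trans ?_
  refine add_le_add_left (le_of_eq ?_) _
  have h3 : gramSchmidtNormed ℂ (g a) i - gramSchmidt ℂ (g a) i =
      (((‖gramSchmidt ℂ (g a) i‖⁻¹ - 1 : ℝ)) : ℂ) • gramSchmidt ℂ (g a) i := by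
    rw [gramSchmidtNormed]
    push_cast
    rw [sub_smul, one_smul]
    rfl
  rw [h3, norm_smul, Complex.norm_real, Real.norm_eq_abs]

/-- Gram–Schmidt vectors are pairwise orthogonal for every input, so only a zero vector, which
normalization leaves zero, can spoil orthonormality. -/
theorem orthonormal_gramSchmidtNormed_of_ne_zero {E : Type*} [NormedAddCommGroup E]
    [InnerProductSpace ℂ E] {g : κ → E} (h : ∀ i, gramSchmidt ℂ g i ≠ 0) :
    Orthonormal ℂ (gramSchmidtNormed ℂ g) := by
  refine ⟨fun i => ?_, fun i j hij => ?_⟩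
  · rw [gramSchmidtNormed]
    exact norm_smul_inv_norm (h i)
  · simp [gramSchmidtNormed, inner_smul_left, inner_smul_right, gramSchmidt_orthogonal ℂ g hij]

theorem eventually_orthonormal_gramSchmidtNormed [Finite κ]
    (hg : ∀ i, Tendsto (fun a => inner ℂ (g a i) (g a i)) l (𝓝 1))
    (hg' : ∀ i j, i ≠ j → Tendsto (fun a => inner ℂ (g a i) (g a j)) l (𝓝 0)) :
    ∀ᶠ a in l, Orthonormal ℂ (gramSchmidtNormed ℂ (g a)) := by
  have h : ∀ᶠ a in l, ∀ i, gramSchmidt ℂ (g a) i ≠ 0 := by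
    refine eventually_all.mpr fun i => ?_
    filter_upwards [(tendsto_norm_gramSchmidt hg hg' i).eventually_ne one_ne_zero] with a ha
    exact norm_ne_zero_iff.mp ha
  filter_upwards [h] with a ha using orthonormal_gramSchmidtNormed_of_ne_zero ha

end GramSchmidt

/-! ### Homogeneous extension of degree two -/

section Homogeneous

variable {H : Type*} [NormedAddCommGroup H] [InnerProductSpace ℂ H]

open Classical in
/-- The extension of a function on the unit sphere to a function on `H` that is homogeneous of
degree `2`. -/
noncomputable def homogExtend (f : UnitSphere H → ℝ) (v : H) : ℝ :=
  if h : v = 0 then 0 else ‖v‖ ^ 2 * f (normalize ⟨v, h⟩)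

@[simp] theorem homogExtend_zero (f : UnitSphere H → ℝ) : homogExtend f 0 = 0 := by
  simp [homogExtend]

theorem homogExtend_of_ne (f : UnitSphere H → ℝ) {v : H} (h : v ≠ 0) :
    homogExtend f v = ‖v‖ ^ 2 * f (normalize ⟨v, h⟩) := by
  simp [homogExtend, h]

/-- Degree 2 is what later turns the scaling `m^(-1/2)` of the Gaussian vectors into the weight
`1/m` of an average. -/
theorem homogExtend_smul (f : UnitSphere H → ℝ) {c : ℝ} (hc : 0 ≤ c) (v : H) :
    homogExtend f ((c : ℂ) • v) = c ^ 2 * homogExtend f v := by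
  rcases eq_or_lt_of_le hc with rfl | hc
  · simp
  by_cases h : v = 0
  · simp [h]
  have h' : (c : ℂ) • v ≠ 0 := smul_ne_zero (by exact_mod_cast hc.ne') h
  have hn : ‖(c : ℂ) • v‖ = c * ‖v‖ := by
    rw [norm_smul, Complex.norm_real, Real.norm_of_nonneg hc.le]
  rw [homogExtend_of_ne f h, homogExtend_of_ne f h', hn]
  have : normalize ⟨(c : ℂ) • v, h'⟩ = normalize ⟨v, h⟩ := by
    apply Subtype.ext
    have hc' : (c : ℂ) ≠ 0 := by exact_mod_cast hc.ne'
    have hv : (‖v‖ : ℂ) ≠ 0 := by exact_mod_cast norm_ne_zero_iff.mpr h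
    simp only [normalize, hn, smul_smul]
    congr 1
    push_cast
    field_simp
  rw [this]
  ring

theorem abs_homogExtend_le (f : UnitSphere H →ᵇ ℝ) (v : H) :
    |homogExtend f v| ≤ ‖f‖ * ‖v‖ ^ 2 := by
  by_cases h : v = 0
  · simp [h]
  rw [homogExtend_of_ne _ h, abs_mul, abs_of_nonneg (by positivity), mul_comm]
  exact mul_le_mul_of_nonneg_right (f.norm_coe_le_norm _) (by positivity)

theorem continuous_normalize : Continuous (normalize : {ψ : H // ψ ≠ 0} → UnitSphere H) := by
  refine Continuous.subtype_mk ?_ _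
  refine Continuous.smul ?_ continuous_subtype_val
  refine Complex.continuous_ofReal.comp ?_
  exact continuous_subtype_val.norm.inv₀ fun x => norm_ne_zero_iff.mpr x.2

/-- Only the origin needs an argument: normalization has no limit there, but the bound `‖f‖ * ‖v‖ ^
2` forces the value 0. -/
theorem continuous_homogExtend (f : UnitSphere H →ᵇ ℝ) : Continuous (homogExtend f) := by
  rw [continuous_iff_continuousAt]
  intro v
  by_cases h : v = 0
  · subst h
    rw [ContinuousAt, homogExtend_zero]
    refine squeeze_zero_norm (fun v => abs_homogExtend_le f v) ?_
    have : Continuous fun v : H => ‖f‖ * ‖v‖ ^ 2 := by fun_prop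
    simpa using this.tendsto 0
  · have ho : IsOpen {ψ : H | ψ ≠ 0} := isOpen_ne
    have hc : ContinuousOn (homogExtend f) {ψ : H | ψ ≠ 0} := by
      rw [continuousOn_iff_continuous_domRestrict]
      have h2 : Continuous fun x : {ψ : H // ψ ≠ 0} => ‖(x : H)‖ ^ 2 * f (normalize x) :=
        (continuous_subtype_val.norm.pow 2).mul (f.continuous.comp continuous_normalize)
      exact h2.congr fun x => (homogExtend_of_ne f x.2).symm
    exact hc.continuousAt (ho.mem_nhds h)

/-- A quadratic-growth modulus of continuity for functions that are homogeneous of degree `2`. -/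
theorem exists_abs_homogExtend_sub_le [ProperSpace H] (f : UnitSphere H →ᵇ ℝ) {η : ℝ}
    (hη : 0 < η) : ∃ C, 0 ≤ C ∧ ∀ v w, |homogExtend f v - homogExtend f w| ≤
      η * (‖v‖ ^ 2 + ‖w‖ ^ 2) + C * ‖v - w‖ ^ 2 := by
  have huc : UniformContinuousOn (homogExtend f) (Metric.closedBall (0 : H) 1) :=
    (isCompact_closedBall (0 : H) 1).uniformContinuousOn_of_continuous
      (continuous_homogExtend f).continuousOn
  obtain ⟨δ, hδ, hδ'⟩ := Metric.uniformContinuousOn_iff.mp huc η hη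
  -- The constant serves vectors that are far apart: if `‖w‖ ≤ ‖v‖` and `δ * ‖v‖ ≤ ‖v - w‖`, the
  -- trivial bound `2 * ‖f‖ * ‖v‖ ^ 2` is at most `C * ‖v - w‖ ^ 2`.
  refine ⟨2 * ‖f‖ / δ ^ 2, by positivity, ?_⟩
  have main : ∀ v w : H, ‖w‖ ≤ ‖v‖ → |homogExtend f v - homogExtend f w| ≤
      η * (‖v‖ ^ 2 + ‖w‖ ^ 2) + 2 * ‖f‖ / δ ^ 2 * ‖v - w‖ ^ 2 := by
    intro v w hwv
    by_cases hv : v = 0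
    · have hw : w = 0 := by simpa [hv] using hwv
      simp [hv, hw]
    have hv' : 0 < ‖v‖ := norm_pos_iff.mpr hv
    by_cases hd : ‖v - w‖ < δ * ‖v‖
    -- Close vectors: dividing both by `‖v‖` brings them into the unit ball at distance less than
    -- `δ`, and homogeneity restores the factor `‖v‖ ^ 2`.
    · have hs : ∀ x : H, ‖((‖v‖⁻¹ : ℝ) : ℂ) • x‖ = ‖v‖⁻¹ * ‖x‖ := fun x => by
        rw [norm_smul, Complex.norm_real, Real.norm_of_nonneg (by positivity)]
      have h1 : ((‖v‖⁻¹ : ℝ) : ℂ) • v ∈ Metric.closedBall (0 : H) 1 := by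
        rw [mem_closedBall_zero_iff, hs, inv_mul_cancel₀ hv'.ne']
      have h2 : ((‖v‖⁻¹ : ℝ) : ℂ) • w ∈ Metric.closedBall (0 : H) 1 := by
        rw [mem_closedBall_zero_iff, hs, inv_mul_le_iff₀ hv', mul_one]
        exact hwv
      have h3 := hδ' _ h1 _ h2 (by
        rw [dist_eq_norm, ← smul_sub, hs, inv_mul_lt_iff₀ hv', mul_comm]
        exact hd)
      rw [Real.dist_eq, homogExtend_smul f (by positivity), homogExtend_smul f (by positivity),
        ← mul_sub, abs_mul, abs_of_nonneg (by positivity), inv_pow,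
        inv_mul_lt_iff₀ (by positivity)] at h3
      have h4 : 0 ≤ η * ‖w‖ ^ 2 := by positivity
      have h5 : 0 ≤ 2 * ‖f‖ / δ ^ 2 * ‖v - w‖ ^ 2 := by positivity
      nlinarith
    · push Not at hd
      have h1 := abs_homogExtend_le f v
      have h2 := abs_homogExtend_le f w
      have h3 : ‖w‖ ^ 2 ≤ ‖v‖ ^ 2 := by gcongr
      have h4 : (δ * ‖v‖) ^ 2 ≤ ‖v - w‖ ^ 2 := by gcongr
      have h5 : 2 * ‖f‖ * ‖v‖ ^ 2 ≤ 2 * ‖f‖ / δ ^ 2 * ‖v - w‖ ^ 2 := by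
        calc 2 * ‖f‖ * ‖v‖ ^ 2 = 2 * ‖f‖ / δ ^ 2 * (δ * ‖v‖) ^ 2 := by field_simp
          _ ≤ _ := by gcongr
      have h6 : ‖f‖ * ‖w‖ ^ 2 ≤ ‖f‖ * ‖v‖ ^ 2 := by gcongr
      have h7 : 0 ≤ η * (‖v‖ ^ 2 + ‖w‖ ^ 2) := by positivity
      calc _ ≤ |homogExtend f v| + |homogExtend f w| := abs_sub _ _
        _ ≤ _ := by linarith
  intro v w
  rcases le_total ‖w‖ ‖v‖ with h | h
  · exact main v w h
  · rw [abs_sub_comm, norm_sub_rev, add_comm (‖v‖ ^ 2)]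
    exact main w v h

end Homogeneous

end GAPMeasure

namespace GAPMeasure

/-! ### Moments and characteristic function of the complex Gaussian -/

section ComplexGaussian

instance isProbabilityMeasure_complexGaussian (p : ℝ) :
    IsProbabilityMeasure (complexGaussian p) :=
  Measure.isProbabilityMeasure_map (Measurable.aemeasurable (by fun_prop))

theorem complexGaussian_eq_map_one {p : ℝ} (hp : 0 ≤ p) :
    complexGaussian p = (complexGaussian 1).map (fun z => ((√p : ℝ) : ℂ) * z) := by
  have h : gaussianReal 0 (p / 2).toNNReal =
      (gaussianReal 0 (1 / 2 : ℝ).toNNReal).map (fun x => √p * x) := by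
    rw [gaussianReal_map_const_mul, mul_zero]
    congr 1
    apply NNReal.eq
    simp [Real.sq_sqrt hp, Real.coe_toNNReal _ (show 0 ≤ p / 2 by positivity)]
    ring
  rw [complexGaussian, h, complexGaussian, Measure.map_map (by fun_prop) (by fun_prop),
    Measure.map_prod_map _ _ (by fun_prop) (by fun_prop),
    Measure.map_map (by fun_prop) (by fun_prop)]
  congr 1
  funext x
  simp
  ring

theorem charFun_complexGaussian_one (t : ℂ) :
    charFun (complexGaussian 1) t = Complex.exp (-(‖t‖ ^ 2 : ℝ) / 4) := by
  rw [charFun_apply, complexGaussian, integral_map (Measurable.aemeasurable (by fun_prop))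
    (Measurable.aestronglyMeasurable (by fun_prop))]
  have h : ∀ x : ℝ × ℝ, Complex.exp (((inner ℝ ((x.1 : ℂ) + x.2 * Complex.I) t : ℝ) : ℂ)
      * Complex.I) = Complex.exp (t.re * x.1 * Complex.I) *
        Complex.exp (t.im * x.2 * Complex.I) := by
    intro x
    rw [← Complex.exp_add, Complex.inner]
    congr 1
    simp
    ring
  simp_rw [h]
  rw [integral_prod_mul (fun x : ℝ => Complex.exp (t.re * x * Complex.I))
    (fun x : ℝ => Complex.exp (t.im * x * Complex.I)), ← charFun_apply_real,
    ← charFun_apply_real, charFun_gaussianReal, charFun_gaussianReal, ← Complex.exp_add,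
    Complex.sq_norm, Complex.normSq_apply]
  congr 1
  simp
  ring

theorem integrable_norm_sq_complexGaussian :
    Integrable (fun z : ℂ => ‖z‖ ^ 2) (complexGaussian 1) := by
  rw [complexGaussian, integrable_map_measure (by fun_prop) (by fun_prop)]
  have h : (fun z : ℂ => ‖z‖ ^ 2) ∘ (fun x : ℝ × ℝ => (x.1 : ℂ) + (x.2 : ℂ) * Complex.I) =
      fun x => x.1 ^ 2 + x.2 ^ 2 := by
    funext x
    simp [Complex.sq_norm, Complex.normSq_apply]
    ring
  rw [h]
  have h2 : Integrable (fun x : ℝ => x ^ 2) (gaussianReal 0 (1 / 2 : ℝ).toNNReal) :=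
    (memLp_id_gaussianReal 2).integrable_sq
  exact (h2.comp_fst _).add (h2.comp_snd _)

theorem integral_norm_sq_complexGaussian : ∫ z, ‖z‖ ^ 2 ∂(complexGaussian 1) = 1 := by
  rw [complexGaussian, integral_map (by fun_prop) (by fun_prop)]
  have h : ∀ x : ℝ × ℝ, ‖(x.1 : ℂ) + (x.2 : ℂ) * Complex.I‖ ^ 2 = x.1 ^ 2 + x.2 ^ 2 := by
    intro x
    simp [Complex.sq_norm, Complex.normSq_apply]
    ring
  simp_rw [h]
  have h2 : Integrable (fun x : ℝ => x ^ 2) (gaussianReal 0 (1 / 2 : ℝ).toNNReal) :=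
    (memLp_id_gaussianReal 2).integrable_sq
  have h3 : ∫ x, x ^ 2 ∂(gaussianReal 0 (1 / 2 : ℝ).toNNReal) = 1 / 2 := by
    have := variance_of_integral_eq_zero (μ := gaussianReal 0 (1 / 2 : ℝ).toNNReal)
      (X := fun x => x) (by fun_prop) (by simp)
    rw [← this, variance_fun_id_gaussianReal]
    simp
  rw [integral_add (h2.comp_fst _) (h2.comp_snd _), integral_fun_fst (fun x : ℝ => x ^ 2),
    integral_fun_snd (fun x : ℝ => x ^ 2), h3]
  norm_num

theorem integral_id_complexGaussian : ∫ z, z ∂(complexGaussian 1) = 0 := by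
  rw [complexGaussian, integral_map (by fun_prop) (by fun_prop)]
  have h : Integrable (fun x : ℝ => (x : ℂ)) (gaussianReal 0 (1 / 2 : ℝ).toNNReal) :=
    ((memLp_id_gaussianReal 1).integrable le_rfl).ofReal
  have h0 : ∫ x : ℝ, (x : ℂ) ∂(gaussianReal 0 (1 / 2 : ℝ).toNNReal) = 0 := by
    rw [integral_complex_ofReal]
    simp
  rw [integral_add (h.comp_fst _) ((h.comp_snd _).mul_const _), integral_mul_const,
    integral_fun_fst (fun x : ℝ => (x : ℂ)), integral_fun_snd (fun x : ℝ => (x : ℂ)), h0]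
  simp

variable {κ : Type*} [Fintype κ]

theorem integrable_norm_sq_eval (i : κ) :
    Integrable (fun z : κ → ℂ => ‖z i‖ ^ 2) (Measure.pi fun _ => complexGaussian 1) :=
  integrable_comp_eval (X := fun _ => ℂ) (μ := fun _ => complexGaussian 1) (i := i)
    (f := fun z : ℂ => ‖z‖ ^ 2) integrable_norm_sq_complexGaussian

theorem memLp_two_eval (i : κ) :
    MemLp (fun z : κ → ℂ => z i) 2 (Measure.pi fun _ => complexGaussian 1) :=
  (memLp_two_iff_integrable_sq_norm (measurable_pi_apply i).aestronglyMeasurable).mpr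
    (integrable_norm_sq_eval i)

theorem integrable_conj_eval_mul_eval (i j : κ) :
    Integrable (fun z : κ → ℂ => starRingEnd ℂ (z i) * z j)
      (Measure.pi fun _ => complexGaussian 1) :=
  (memLp_two_eval i).star.integrable_mul (memLp_two_eval j)

theorem integral_conj_eval_mul_self (i : κ) :
    ∫ z : κ → ℂ, starRingEnd ℂ (z i) * z i ∂(Measure.pi fun _ => complexGaussian 1) = 1 := by
  have h : ∀ z : ℂ, starRingEnd ℂ z * z = ((‖z‖ ^ 2 : ℝ) : ℂ) := fun z => by
    rw [mul_comm, Complex.mul_conj, Complex.sq_norm]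
  have hc : Continuous fun z : ℂ => starRingEnd ℂ z * z := Complex.continuous_conj.mul continuous_id
  rw [integral_comp_eval (X := fun _ => ℂ) (μ := fun _ => complexGaussian 1) (i := i)
    (f := fun z : ℂ => starRingEnd ℂ z * z) hc.aestronglyMeasurable]
  simp_rw [h]
  rw [integral_complex_ofReal, integral_norm_sq_complexGaussian, Complex.ofReal_one]

theorem integral_conj_eval_mul_of_ne {i j : κ} (hij : i ≠ j) :
    ∫ z : κ → ℂ, starRingEnd ℂ (z i) * z j ∂(Measure.pi fun _ => complexGaussian 1) = 0 := by
  have hind : iIndepFun (fun (i : κ) (z : κ → ℂ) => z i)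
      (Measure.pi fun _ => complexGaussian 1) :=
    iIndepFun_pi (X := fun _ z => z) fun _ => by fun_prop
  have h2 := (hind.indepFun hij).comp (φ := starRingEnd ℂ) (ψ := id)
    Complex.continuous_conj.measurable measurable_id
  have h3 := h2.integral_fun_mul_eq_mul_integral
    (Complex.continuous_conj.measurable.comp (measurable_pi_apply i)).aestronglyMeasurable
    (measurable_id.comp (measurable_pi_apply j)).aestronglyMeasurable
  simp only [Function.comp_apply, id] at h3
  rw [h3, integral_comp_eval (X := fun _ => ℂ) (μ := fun _ => complexGaussian 1) (i := j)
    (f := fun z : ℂ => z) (by fun_prop),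
    integral_id_complexGaussian, mul_zero]

end ComplexGaussian

/-! ### Unitary invariance of Gaussian families -/

section Invariance

variable {κ ι : Type*} [Fintype κ] [Fintype ι]
variable {E : Type*} [NormedAddCommGroup E] [InnerProductSpace ℂ E] [FiniteDimensional ℂ E]
  [MeasurableSpace E] [BorelSpace E]

/-- The law of a family of vectors with independent standard Gaussian coordinates is invariant
under unitary maps. -/
theorem map_gaussianFamily_map (b : OrthonormalBasis ι ℂ E) (V : E ≃ₗᵢ[ℂ] E) :
    (((Measure.pi fun _ : ι => Measure.pi fun _ : κ => complexGaussian 1).map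
      (fun a i => ∑ q, a q i • b q)).map (fun (x : κ → E) i => V (x i))) =
    (Measure.pi fun _ : ι => Measure.pi fun _ : κ => complexGaussian 1).map
      (fun a i => ∑ q, a q i • b q) := by
  have : ProperSpace E := FiniteDimensional.proper ℂ E
  let _ : InnerProductSpace ℝ E := InnerProductSpace.rclikeToReal ℂ E
  have hV : Continuous V := V.continuous
  have hT : Measurable fun (a : ι → κ → ℂ) (i : κ) => ∑ q, a q i • b q := by fun_prop
  -- The characteristic function factors over the coordinates, and Parseval leaves only `‖t‖`. The
  -- result does not depend on `W`, so `W = V` and the identity give the same law.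
  have key : ∀ (W : E ≃ₗᵢ[ℂ] E) (t : PiLp 2 (fun _ : κ => E)),
      charFun ((Measure.pi fun _ : ι => Measure.pi fun _ : κ => complexGaussian 1).map
        (fun a => WithLp.toLp 2 (fun i => W (∑ q, a q i • b q)))) t =
      Complex.exp (-(‖t‖ ^ 2 : ℝ) / 4) := by
    intro W t
    have hW : Continuous W := W.continuous
    have hm : Measurable fun (a : ι → κ → ℂ) =>
        WithLp.toLp 2 (fun i : κ => W (∑ q, a q i • b q)) :=
      (WithLp.measurable_toLp 2 _).comp
        (measurable_pi_lambda _ fun i => hW.measurable.comp (by fun_prop))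
    rw [charFun_apply, integral_map hm.aemeasurable (by fun_prop)]
    have h1 : ∀ a : ι → κ → ℂ, Complex.exp (((inner ℝ (WithLp.toLp 2
        (fun i => W (∑ q, a q i • b q))) t : ℝ) : ℂ) * Complex.I) =
        ∏ q, ∏ i, Complex.exp (((inner ℝ (a q i) (inner ℂ (b q) (W.symm (t i))) : ℝ) : ℂ)
          * Complex.I) := by
      intro a
      simp_rw [← Complex.exp_sum, ← Finset.sum_mul, ← Complex.ofReal_sum]
      congr 3
      rw [PiLp.inner_apply, Finset.sum_comm]
      refine Finset.sum_congr rfl fun i _ => ?_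
      have h2 : (inner ℝ (W (∑ q, a q i • b q)) (t i) : ℝ) =
          (inner ℂ (W (∑ q, a q i • b q)) (t i)).re := rfl
      change (inner ℝ (W (∑ q, a q i • b q)) (t i) : ℝ) = _
      rw [h2, ← W.symm.inner_map_map, W.symm_apply_apply, sum_inner, Complex.re_sum]
      refine Finset.sum_congr rfl fun q _ => ?_
      rw [inner_smul_left, Complex.inner, mul_comm]
    simp_rw [h1]
    rw [integral_fintype_prod_eq_prod (f := fun q (y : κ → ℂ) => ∏ i,
      Complex.exp (((inner ℝ (y i) (inner ℂ (b q) (W.symm (t i))) : ℝ) : ℂ) * Complex.I))]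
    have h3 : ∀ q, ∫ y : κ → ℂ, ∏ i,
        Complex.exp (((inner ℝ (y i) (inner ℂ (b q) (W.symm (t i))) : ℝ) : ℂ) * Complex.I)
        ∂(Measure.pi fun _ => complexGaussian 1) =
        ∏ i, Complex.exp (-(‖inner ℂ (b q) (W.symm (t i))‖ ^ 2 : ℝ) / 4) := by
      intro q
      rw [integral_fintype_prod_eq_prod (f := fun i (y : ℂ) =>
        Complex.exp (((inner ℝ y (inner ℂ (b q) (W.symm (t i))) : ℝ) : ℂ) * Complex.I))]
      simp_rw [← charFun_apply, charFun_complexGaussian_one]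
    simp_rw [h3, ← Complex.exp_sum]
    congr 1
    rw [PiLp.norm_sq_eq_of_L2, Finset.sum_comm]
    simp_rw [← Finset.sum_div, Finset.sum_neg_distrib, ← Complex.ofReal_sum]
    have h4 : ∀ i, ∑ q, ‖inner ℂ (b q) (W.symm (t i))‖ ^ 2 = ‖t i‖ ^ 2 := fun i => by
      rw [b.sum_sq_norm_inner_right, W.symm.norm_map]
    simp_rw [h4]
  have hm : ∀ W : E ≃ₗᵢ[ℂ] E, Measurable fun (a : ι → κ → ℂ) =>
      WithLp.toLp 2 (fun i : κ => W (∑ q, a q i • b q)) := fun W => by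
    have hW := W.continuous.measurable
    refine (WithLp.measurable_toLp 2 _).comp (measurable_pi_lambda _ fun i => hW.comp ?_)
    exact (measurable_pi_apply i).comp hT
  have h : (Measure.pi fun _ : ι => Measure.pi fun _ : κ => complexGaussian 1).map
        (fun a => WithLp.toLp 2 (fun i => V (∑ q, a q i • b q))) =
      (Measure.pi fun _ : ι => Measure.pi fun _ : κ => complexGaussian 1).map
        (fun a => WithLp.toLp 2 (fun i => LinearIsometryEquiv.refl ℂ E (∑ q, a q i • b q))) :=
    Measure.ext_of_charFun (funext fun t => (key V t).trans (key (.refl ℂ E) t).symm)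
  have h3 := congrArg (fun μ => μ.map (WithLp.ofLp : PiLp 2 (fun _ : κ => E) → κ → E)) h
  rw [Measure.map_map (WithLp.measurable_ofLp 2 _) (hm V),
    Measure.map_map (WithLp.measurable_ofLp 2 _) (hm _)] at h3
  have hV' : Measurable fun (x : κ → E) (i : κ) => V (x i) :=
    measurable_pi_lambda _ fun i => hV.measurable.comp (measurable_pi_apply i)
  rw [Measure.map_map hV' hT]
  exact h3

end Invariance

/-! ### `G(ρ)` as an image of the standard Gaussian -/

section Law

variable {H : Type*} [NormedAddCommGroup H] [InnerProductSpace ℂ H] [FiniteDimensional ℂ H]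

/-- The map turning standard Gaussian coordinates into a Gaussian vector with covariance `ρ`. -/
noncomputable def sqrtMap {ρ : H →ₗ[ℂ] H} (hρ : IsDensityMatrix ρ)
    (z : Fin (Module.finrank ℂ H) → ℂ) : H :=
  ∑ i, (((√(hρ.isPositive.isSymmetric.eigenvalues rfl i) : ℝ) : ℂ) * z i) •
    hρ.isPositive.isSymmetric.eigenvectorBasis rfl i

theorem continuous_sqrtMap {ρ : H →ₗ[ℂ] H} (hρ : IsDensityMatrix ρ) :
    Continuous (sqrtMap hρ) := by
  unfold sqrtMap
  fun_prop

theorem eigenvalues_nonneg {ρ : H →ₗ[ℂ] H} (hρ : IsDensityMatrix ρ)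
    (i : Fin (Module.finrank ℂ H)) : 0 ≤ hρ.isPositive.isSymmetric.eigenvalues rfl i :=
  hρ.isPositive.nonneg_eigenvalues rfl i

theorem gaussian_eq_map [MeasurableSpace H] [BorelSpace H] {ρ : H →ₗ[ℂ] H} (hρ : IsDensityMatrix ρ) :
    gaussian hρ = (Measure.pi fun _ => complexGaussian 1).map (sqrtMap hρ) := by
  have : ProperSpace H := FiniteDimensional.proper ℂ H
  rw [gaussian]
  simp_rw [complexGaussian_eq_map_one (eigenvalues_nonneg hρ _)]
  rw [← Measure.pi_map_pi (by fun_prop), Measure.map_map (by fun_prop) (by fun_prop)]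
  rfl

theorem norm_sq_sqrtMap {ρ : H →ₗ[ℂ] H} (hρ : IsDensityMatrix ρ)
    (z : Fin (Module.finrank ℂ H) → ℂ) :
    ‖sqrtMap hρ z‖ ^ 2 = ∑ i, hρ.isPositive.isSymmetric.eigenvalues rfl i * ‖z i‖ ^ 2 := by
  rw [← (hρ.isPositive.isSymmetric.eigenvectorBasis rfl).sum_sq_norm_inner_right]
  refine Finset.sum_congr rfl fun i _ => ?_
  rw [sqrtMap, (hρ.isPositive.isSymmetric.eigenvectorBasis rfl).orthonormal.inner_right_fintype,
    norm_mul, mul_pow, Complex.norm_real, Real.norm_of_nonneg (Real.sqrt_nonneg _),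
    Real.sq_sqrt (eigenvalues_nonneg hρ i)]

end Law

end GAPMeasure

namespace GAPMeasure

open InnerProductSpace

/-! ### Haar measure and uniform orthonormal systems -/

section Haar

variable {E : Type*} [NormedAddCommGroup E] [InnerProductSpace ℂ E] [FiniteDimensional ℂ E]
  [CompleteSpace E]

instance isProbabilityMeasure_unitaryHaar : IsProbabilityMeasure (unitaryHaar E) :=
  ⟨Measure.haarMeasure_self⟩

instance isHaarMeasure_unitaryHaar : (unitaryHaar E).IsHaarMeasure :=
  inferInstanceAs (Measure.haarMeasure ⊤).IsHaarMeasure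

/-- A right translate of a Haar measure is again a Haar measure; with total mass 1 it must be the
same one. -/
theorem map_mul_right_unitaryHaar (W : unitary (E →L[ℂ] E)) :
    (unitaryHaar E).map (· * W) = unitaryHaar E := by
  have : IsProbabilityMeasure ((unitaryHaar E).map (· * W)) :=
    Measure.isProbabilityMeasure_map (measurable_mul_const W).aemeasurable
  exact Measure.isHaarMeasure_eq_of_isProbabilityMeasure _ _

theorem exists_unitary_apply_stdOrthonormalBasis {k : ℕ} (hk : k ≤ Module.finrank ℂ E)
    {x : Fin k → E} (hx : Orthonormal ℂ x) : ∃ W : unitary (E →L[ℂ] E),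
      ∀ i, (W : E →L[ℂ] E) (stdOrthonormalBasis ℂ E (Fin.castLE hk i)) = x i := by
  classical
  let v : Fin (Module.finrank ℂ E) → E := fun j => if h : (j : ℕ) < k then x ⟨j, h⟩ else 0
  let s : Set (Fin (Module.finrank ℂ E)) := {j | (j : ℕ) < k}
  have hv : Orthonormal ℂ (s.domRestrict v) := by
    have h : s.domRestrict v = x ∘ fun j : s => ⟨j.1, j.2⟩ := by
      funext j
      exact dif_pos j.2
    rw [h]
    exact hx.comp _ fun i j hij => Subtype.ext (Fin.ext (Fin.mk.inj hij))
  obtain ⟨b, hb⟩ := hv.exists_orthonormalBasis_extension_of_card_eq (by simp)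
  refine ⟨Unitary.linearIsometryEquiv.symm ((stdOrthonormalBasis ℂ E).equiv b (Equiv.refl _)),
    fun i => ?_⟩
  have h1 : (stdOrthonormalBasis ℂ E).equiv b (Equiv.refl _)
      (stdOrthonormalBasis ℂ E (Fin.castLE hk i)) = x i := by
    rw [OrthonormalBasis.equiv_apply_basis, Equiv.refl_apply, hb _ (by simp [s])]
    exact dif_pos i.2
  exact h1

omit [FiniteDimensional ℂ E] in
theorem continuous_unitary_apply {κ : Type*} :
    Continuous fun p : unitary (E →L[ℂ] E) × (κ → E) => fun i => (p.1 : E →L[ℂ] E) (p.2 i) := by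
  refine continuous_pi fun i => ?_
  exact (continuous_subtype_val.comp continuous_fst).clm_apply
    ((continuous_apply i).comp continuous_snd)

variable [MeasurableSpace E] [BorelSpace E]

theorem measurable_unitary_frame {k : ℕ} (hk : k ≤ Module.finrank ℂ E) :
    Measurable fun (U : unitary (E →L[ℂ] E)) (i : Fin k) =>
      (U : E →L[ℂ] E) (stdOrthonormalBasis ℂ E (Fin.castLE hk i)) := by
  have : ProperSpace E := FiniteDimensional.proper ℂ E
  exact (continuous_unitary_apply.comp (continuous_id.prodMk continuous_const)).measurable

/-- The Gram–Schmidt orthonormalization of a unitarily invariant random family of vectors is, as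
far as it is orthonormal, at most as likely to hit a given set as the uniformly distributed
orthonormal system. -/
theorem measure_gramSchmidtNormed_le_uniformONS {k : ℕ} (hk : k ≤ Module.finrank ℂ E)
    (μ : Measure (Fin k → E)) [IsProbabilityMeasure μ]
    (hμ : ∀ V : E ≃ₗᵢ[ℂ] E, μ.map (fun x i => V (x i)) = μ)
    {S : Set (Fin k → E)} (hS : MeasurableSet S) (hS' : ∀ x ∈ S, Orthonormal ℂ x) :
    μ {x | gramSchmidtNormed ℂ x ∈ S} ≤ uniformONS hk S := by
  have : ProperSpace E := FiniteDimensional.proper ℂ E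
  have : ProperSpace (E →L[ℂ] E) := FiniteDimensional.proper ℂ _
  have hact := (continuous_unitary_apply (E := E) (κ := Fin k)).measurable
  have hgs := measurable_gramSchmidtNormed (E := E) (κ := Fin k)
  have hS1 : MeasurableSet {x | gramSchmidtNormed ℂ x ∈ S} := hgs hS
  have hmeas : MeasurableSet {p : unitary (E →L[ℂ] E) × (Fin k → E) |
      (fun i => (p.1 : E →L[ℂ] E) (gramSchmidtNormed ℂ p.2 i)) ∈ S} :=
    (hact.comp (measurable_fst.prodMk (hgs.comp measurable_snd))) hS
  -- Invariance of `μ` combined with equivariance of Gram–Schmidt.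
  have hinv : ∀ U : unitary (E →L[ℂ] E),
      μ {x | (fun i => (U : E →L[ℂ] E) (gramSchmidtNormed ℂ x i)) ∈ S} =
        μ {x | gramSchmidtNormed ℂ x ∈ S} := by
    intro U
    conv_rhs => rw [← hμ (Unitary.linearIsometryEquiv U)]
    rw [Measure.map_apply _ hS1]
    · congr 1
      ext x
      have h : gramSchmidtNormed ℂ (fun i => Unitary.linearIsometryEquiv U (x i)) =
          fun i => (U : E →L[ℂ] E) (gramSchmidtNormed ℂ x i) :=
        funext fun i => gramSchmidtNormed_map
          (Unitary.linearIsometryEquiv U).toLinearIsometry x i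
      change _ ↔ gramSchmidtNormed ℂ (fun i => Unitary.linearIsometryEquiv U (x i)) ∈ S
      rw [h]
      rfl
    · exact measurable_pi_lambda _ fun i =>
        (Unitary.linearIsometryEquiv U).continuous.measurable.comp (measurable_pi_apply i)
  -- An orthonormal `x` is the image of the standard frame under some unitary `W`, which right
  -- invariance absorbs. For any other `x` the event is empty, since a unitary cannot make `x`
  -- orthonormal.
  have hconst : ∀ x : Fin k → E, unitaryHaar E {U | (fun i => (U : E →L[ℂ] E) (x i)) ∈ S} ≤
      uniformONS hk S := by
    intro x
    by_cases hx : Orthonormal ℂ x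
    · obtain ⟨W, hW⟩ := exists_unitary_apply_stdOrthonormalBasis hk hx
      have h1 := measurable_unitary_frame (E := E) hk
      rw [uniformONS, Measure.map_apply h1 hS]
      conv_rhs => rw [← map_mul_right_unitaryHaar W]
      rw [Measure.map_apply (measurable_mul_const W) (h1 hS)]
      refine measure_mono fun U hU => ?_
      have h2 : (fun i => ((U * W : unitary (E →L[ℂ] E)) : E →L[ℂ] E)
          (stdOrthonormalBasis ℂ E (Fin.castLE hk i))) = fun i => (U : E →L[ℂ] E) (x i) :=
        funext fun i => by rw [← hW i]; rfl
      change (fun i => ((U * W : unitary (E →L[ℂ] E)) : E →L[ℂ] E)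
          (stdOrthonormalBasis ℂ E (Fin.castLE hk i))) ∈ S
      rw [h2]
      exact hU
    · have h1 : {U : unitary (E →L[ℂ] E) | (fun i => (U : E →L[ℂ] E) (x i)) ∈ S} = ∅ := by
        refine Set.eq_empty_of_forall_notMem fun U hU => hx ?_
        have := hS' _ hU
        exact ((Unitary.linearIsometryEquiv U).toLinearIsometry.orthonormal_comp_iff).mp this
      rw [h1, measure_empty]
      exact zero_le
  -- Average over a Haar unitary `U` independent of `x`, then exchange the order of integration.
  calc μ {x | gramSchmidtNormed ℂ x ∈ S}
      = ∫⁻ U, μ {x | (fun i => (U : E →L[ℂ] E) (gramSchmidtNormed ℂ x i)) ∈ S}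
          ∂(unitaryHaar E) := by simp_rw [hinv]; simp
    _ = ((unitaryHaar E).prod μ) {p | (fun i => (p.1 : E →L[ℂ] E)
          (gramSchmidtNormed ℂ p.2 i)) ∈ S} := (Measure.prod_apply hmeas).symm
    _ = ∫⁻ x, unitaryHaar E {U | (fun i => (U : E →L[ℂ] E) (gramSchmidtNormed ℂ x i)) ∈ S} ∂μ :=
        Measure.prod_apply_symm hmeas
    _ ≤ ∫⁻ _, uniformONS hk S ∂μ := lintegral_mono fun x => hconst _
    _ = uniformONS hk S := by simp

end Haar

end GAPMeasure

namespace GAPMeasure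

open InnerProductSpace

/-! ### Both measures as integrals of the homogeneous extension -/

section Integrals

variable {H : Type*} [NormedAddCommGroup H] [InnerProductSpace ℂ H] [FiniteDimensional ℂ H]
  [MeasurableSpace H] [BorelSpace H]

/-- The integral with respect to `GAP(ρ)` as a Gaussian expectation. -/
theorem integral_gap {ρ : H →ₗ[ℂ] H} (hρ : IsDensityMatrix ρ) (f : UnitSphere H →ᵇ ℝ) :
    ∫ x, f x ∂(gap hρ) = ∫ z, homogExtend f (sqrtMap hρ z) ∂(Measure.pi fun _ =>
      complexGaussian 1) := by
  have : ProperSpace H := FiniteDimensional.proper ℂ H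
  have hms : MeasurableSet {ψ : H | ψ ≠ 0} := isOpen_ne.measurableSet
  have hc : Continuous fun v : H => ‖v‖₊ ^ 2 := by fun_prop
  have h1 : adjustedGaussian hρ = (gaussian hρ).withDensity (fun v => ((‖v‖₊ ^ 2 : NNReal) : ℝ≥0∞)) := by
    rw [adjustedGaussian]
    congr 1
    funext v
    rw [ENNReal.ofReal_pow (norm_nonneg _), ofReal_norm]
    rfl
  -- The factor `‖x‖⁻²` produced here cancels the density `‖x‖ ^ 2` of `GA(ρ)`.
  have h2 : ∀ x : {ψ : H // ψ ≠ 0}, f (normalize x) = (‖(x : H)‖ ^ 2)⁻¹ * homogExtend f x := by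
    intro x
    have : ‖(x : H)‖ ^ 2 ≠ 0 := pow_ne_zero _ (norm_ne_zero_iff.mpr x.2)
    rw [homogExtend_of_ne f x.2, inv_mul_cancel_left₀ this]
  rw [gap, integral_map continuous_normalize.measurable.aemeasurable
    f.continuous.aestronglyMeasurable]
  simp_rw [h2]
  have h3 : ∫ x : {ψ : H // ψ ≠ 0}, (‖(x : H)‖ ^ 2)⁻¹ * homogExtend f x
      ∂((adjustedGaussian hρ).comap Subtype.val) = _ :=
    integral_subtype_comap hms (fun v : H => (‖v‖ ^ 2)⁻¹ * homogExtend f v)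
  rw [h3,
    setIntegral_eq_integral_of_forall_compl_eq_zero, h1,
    integral_withDensity_eq_integral_smul hc.measurable, gaussian_eq_map,
    integral_map (continuous_sqrtMap hρ).measurable.aemeasurable]
  · refine integral_congr_ae (Eventually.of_forall fun z => ?_)
    by_cases h : sqrtMap hρ z = 0
    · simp [h]
    · have : ‖sqrtMap hρ z‖ ^ 2 ≠ 0 := pow_ne_zero _ (norm_ne_zero_iff.mpr h)
      simp only [NNReal.smul_def, smul_eq_mul, NNReal.coe_pow, coe_nnnorm]
      rw [mul_inv_cancel_left₀ this]
  · have hF := (continuous_homogExtend f).measurable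
    refine (hc.measurable.smul (Measurable.mul ?_ hF)).aestronglyMeasurable
    fun_prop
  -- The restriction to nonzero vectors can be dropped because the integrand is 0 at the origin.
  · intro v hv
    have : v = 0 := by simpa using hv
    simp [this]

/-- The integral with respect to the law of the conditional wave function. -/
theorem integral_conditionalLaw {H₂ : Type*} [NormedAddCommGroup H₂] [InnerProductSpace ℂ H₂]
    {ι : Type*} [Fintype ι] (b : OrthonormalBasis ι ℂ H₂) (ψ : H ⊗[ℂ] H₂)
    (f : UnitSphere H →ᵇ ℝ) :
    ∫ x, f x ∂(conditionalLaw b ψ) = ∑ q, homogExtend f (partialInner (b q) ψ) := by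
  have : ProperSpace H := FiniteDimensional.proper ℂ H
  rw [conditionalLaw, integral_finsetSum_measure]
  · refine Finset.sum_congr rfl fun q _ => ?_
    by_cases h : partialInner (b q) ψ = 0
    · simp [h]
    · rw [dif_neg h, homogExtend_of_ne f h, integral_smul_measure, integral_dirac,
        ENNReal.toReal_ofReal (by positivity), smul_eq_mul]
  · intro q _
    by_cases h : partialInner (b q) ψ = 0
    · simp [h]
    · rw [dif_neg h]
      exact (f.integrable _).smul_measure ENNReal.ofReal_ne_top

omit [MeasurableSpace H] [BorelSpace H] in
theorem integrable_homogExtend_sqrtMap {ρ : H →ₗ[ℂ] H} (hρ : IsDensityMatrix ρ)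
    (f : UnitSphere H →ᵇ ℝ) :
    Integrable (fun z => homogExtend f (sqrtMap hρ z)) (Measure.pi fun _ =>
      complexGaussian 1) := by
  have h : Integrable (fun z : Fin (Module.finrank ℂ H) → ℂ =>
      ‖f‖ * ∑ i, hρ.isPositive.isSymmetric.eigenvalues rfl i * ‖z i‖ ^ 2)
      (Measure.pi fun _ => complexGaussian 1) :=
    (integrable_finsetSum _ fun i _ => (integrable_norm_sq_eval i).const_mul _).const_mul _
  refine h.mono' ((continuous_homogExtend f).comp (continuous_sqrtMap hρ)).aestronglyMeasurable
    (Eventually.of_forall fun z => ?_)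
  rw [← norm_sq_sqrtMap]
  exact abs_homogExtend_le f _

end Integrals

/-! ### Purifications and their reduced density matrices -/

section Reduced

variable {H₁ : Type*} [NormedAddCommGroup H₁] [InnerProductSpace ℂ H₁] [FiniteDimensional ℂ H₁]
variable {H₂ : Type*} [NormedAddCommGroup H₂] [InnerProductSpace ℂ H₂]

/-- The vector `∑ i, √pᵢ χᵢ ⊗ φᵢ`. -/
noncomputable def purification {ρ : H₁ →ₗ[ℂ] H₁} (hρ : IsDensityMatrix ρ)
    (φ : Fin (Module.finrank ℂ H₁) → H₂) : H₁ ⊗[ℂ] H₂ :=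
  ∑ i, ((√(hρ.isPositive.isSymmetric.eigenvalues rfl i) : ℝ) : ℂ) •
    (hρ.isPositive.isSymmetric.eigenvectorBasis rfl i ⊗ₜ[ℂ] φ i)

theorem partialInner_purification {ρ : H₁ →ₗ[ℂ] H₁} (hρ : IsDensityMatrix ρ)
    (φ : Fin (Module.finrank ℂ H₁) → H₂) (q : H₂) :
    partialInner q (purification hρ φ) = sqrtMap hρ fun i => inner ℂ q (φ i) := by
  simp only [purification, partialInner, sqrtMap, map_sum, map_smul]
  refine Finset.sum_congr rfl fun i _ => ?_
  rw [← smul_smul]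
  simp

theorem continuous_purification {ρ : H₁ →ₗ[ℂ] H₁} (hρ : IsDensityMatrix ρ) :
    Continuous (purification (H₂ := H₂) hρ) := by
  refine continuous_finsetSum _ fun i _ => ?_
  have h : Continuous fun φ : Fin (Module.finrank ℂ H₁) → H₂ =>
      hρ.isPositive.isSymmetric.eigenvectorBasis rfl i ⊗ₜ[ℂ] φ i :=
    TensorProduct.continuous_tmul.comp (continuous_const.prodMk (continuous_apply i))
  exact h.const_smul (((√(hρ.isPositive.isSymmetric.eigenvalues rfl i) : ℝ) : ℂ))

variable [FiniteDimensional ℂ H₂]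

/-- The rank-one operator of product vectors is a tensor product of rank-one operators, and the
trace of the second factor is an inner product. -/
theorem partialTrace_rankOne_tmul (a c : H₁) (b d : H₂) :
    partialTrace (InnerProductSpace.rankOne ℂ (a ⊗ₜ[ℂ] b) (c ⊗ₜ[ℂ] d)).toLinearMap =
      (inner ℂ d b : ℂ) • (InnerProductSpace.rankOne ℂ a c).toLinearMap := by
  have h : (InnerProductSpace.rankOne ℂ (a ⊗ₜ[ℂ] b) (c ⊗ₜ[ℂ] d)).toLinearMap =
      homTensorHomEquiv ℂ H₁ H₂ H₁ H₂ ((InnerProductSpace.rankOne ℂ a c).toLinearMap ⊗ₜ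
        (InnerProductSpace.rankOne ℂ b d).toLinearMap) := by
    rw [homTensorHomEquiv_apply]
    ext x y
    simp [TensorProduct.smul_tmul, TensorProduct.tmul_smul, smul_smul, mul_comm]
  rw [h, partialTrace]
  simp only [LinearMap.coe_comp, LinearEquiv.coe_coe, Function.comp_apply,
    LinearEquiv.symm_apply_apply, LinearMap.lTensor_tmul, TensorProduct.rid_tmul, trace_rankOne]

/-- The vectors `χᵢ ⊗ φᵢ` are orthonormal, so the squared norm is `∑ pᵢ = tr ρ = 1`. In the partial
trace the cross terms carry the factor `⟨φⱼ|φᵢ⟩ = 0`, which leaves the spectral decomposition of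
`ρ`. -/
theorem purification_mem_withReduced {ρ : H₁ →ₗ[ℂ] H₁} (hρ : IsDensityMatrix ρ)
    {φ : Fin (Module.finrank ℂ H₁) → H₂} (hφ : Orthonormal ℂ φ) :
    purification hρ φ ∈ withReduced ρ := by
  set p := hρ.isPositive.isSymmetric.eigenvalues rfl with hp
  set χ := hρ.isPositive.isSymmetric.eigenvectorBasis rfl with hχ
  have hsum : ∑ i, p i = 1 := by
    have h := hρ.isPositive.isSymmetric.trace_eq_sum_eigenvalues rfl
    rw [hρ.trace_eq_one] at h
    have h' : ((∑ i, p i : ℝ) : ℂ) = 1 := h.symm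
    exact_mod_cast h'
  have hsq : ∀ i, ((√(p i) : ℝ) : ℂ) * ((√(p i) : ℝ) : ℂ) = p i := fun i => by
    rw [← Complex.ofReal_mul, Real.mul_self_sqrt (eigenvalues_nonneg hρ i)]
  have hon : Orthonormal ℂ fun i => χ i ⊗ₜ[ℂ] φ i := by
    rw [orthonormal_iff_ite] at hφ ⊢
    intro i j
    rw [TensorProduct.inner_tmul, hφ, orthonormal_iff_ite.mp χ.orthonormal]
    split_ifs <;> simp
  constructor
  · have h : inner ℂ (purification hρ φ) (purification hρ φ) = (1 : ℂ) := by
      rw [purification, hon.inner_sum]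
      simp_rw [Complex.conj_ofReal, ← hp, hsq]
      exact_mod_cast hsum
    rw [norm_eq_sqrt_re_inner (𝕜 := ℂ), h]
    simp
  · have h : (rankOne ℂ (purification hρ φ) (purification hρ φ)).toLinearMap =
        ∑ i, ∑ j, (((√(p i) : ℝ) : ℂ) * ((√(p j) : ℝ) : ℂ)) •
          (rankOne ℂ (χ i ⊗ₜ[ℂ] φ i) (χ j ⊗ₜ[ℂ] φ j)).toLinearMap := by
      refine LinearMap.ext fun z => ?_
      simp only [LinearMap.sum_apply, LinearMap.smul_apply, ContinuousLinearMap.coe_coe,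
        rankOne_apply]
      rw [purification, sum_inner, Finset.sum_smul_sum, Finset.sum_comm]
      refine Finset.sum_congr rfl fun i _ => Finset.sum_congr rfl fun j _ => ?_
      have h5 : inner ℂ (((√(p j) : ℝ) : ℂ) • (χ j ⊗ₜ[ℂ] φ j)) z =
          ((√(p j) : ℝ) : ℂ) * inner ℂ (χ j ⊗ₜ[ℂ] φ j) z :=
        (inner_smul_left (𝕜 := ℂ) (χ j ⊗ₜ[ℂ] φ j) z ((√(p j) : ℝ) : ℂ)).trans
          (congrArg (· * inner ℂ (χ j ⊗ₜ[ℂ] φ j) z) (Complex.conj_ofReal _))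
      rw [← hp, ← hχ, h5, smul_smul, smul_smul]
      congr 1
      ring
    rw [reducedDensity, h]
    simp_rw [map_sum, map_smul, partialTrace_rankOne_tmul, orthonormal_iff_ite.mp hφ, smul_smul,
      mul_ite, mul_one, mul_zero, ite_smul, zero_smul, Finset.sum_ite_eq', Finset.mem_univ,
      if_true, hsq]
    refine χ.toBasis.ext fun l => ?_
    have h2 : ρ (χ l) = (p l : ℂ) • χ l :=
      hρ.isPositive.isSymmetric.apply_eigenvectorBasis rfl l
    simp [h2, orthonormal_iff_ite.mp χ.orthonormal]

end Reduced

end GAPMeasure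

namespace GAPMeasure

open InnerProductSpace

/-! ### Stability of the sum over conditional vectors -/

section Comparison

variable {H : Type*} [NormedAddCommGroup H] [InnerProductSpace ℂ H] [FiniteDimensional ℂ H]

theorem sqrtMap_sub {ρ : H →ₗ[ℂ] H} (hρ : IsDensityMatrix ρ)
    (z w : Fin (Module.finrank ℂ H) → ℂ) :
    sqrtMap hρ (z - w) = sqrtMap hρ z - sqrtMap hρ w := by
  simp only [sqrtMap, ← Finset.sum_sub_distrib, ← sub_smul, ← mul_sub, Pi.sub_apply]

theorem sqrtMap_smul {ρ : H →ₗ[ℂ] H} (hρ : IsDensityMatrix ρ) (c : ℂ)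
    (z : Fin (Module.finrank ℂ H) → ℂ) : sqrtMap hρ (fun i => c * z i) = c • sqrtMap hρ z := by
  simp only [sqrtMap, Finset.smul_sum, smul_smul, mul_left_comm]

/-- Parseval for each `φ i`. It makes the summed modulus of continuity independent of the number of
basis vectors. -/
theorem sum_norm_sq_sqrtMap_inner {ρ : H →ₗ[ℂ] H} (hρ : IsDensityMatrix ρ) {E : Type*}
    [NormedAddCommGroup E] [InnerProductSpace ℂ E] {ι : Type*} [Fintype ι]
    (b : OrthonormalBasis ι ℂ E) (φ : Fin (Module.finrank ℂ H) → E) :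
    ∑ q, ‖sqrtMap hρ (fun i => inner ℂ (b q) (φ i))‖ ^ 2 =
      ∑ i, hρ.isPositive.isSymmetric.eigenvalues rfl i * ‖φ i‖ ^ 2 := by
  simp_rw [norm_sq_sqrtMap]
  rw [Finset.sum_comm]
  simp_rw [← Finset.mul_sum, b.sum_sq_norm_inner_right]

/-- The sum of `homogExtend f` over the conditional vectors hardly changes if the family `φ` is
slightly perturbed. -/
theorem tendsto_sum_homogExtend_sub {ρ : H →ₗ[ℂ] H} (hρ : IsDensityMatrix ρ)
    (f : UnitSphere H →ᵇ ℝ) {α : Type*} {l : Filter α} {E : α → Type*}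
    [∀ a, NormedAddCommGroup (E a)] [∀ a, InnerProductSpace ℂ (E a)] {ι : α → Type*}
    [∀ a, Fintype (ι a)] (b : ∀ a, OrthonormalBasis (ι a) ℂ (E a))
    {φ g : ∀ a, Fin (Module.finrank ℂ H) → E a} (hg : ∀ i, Tendsto (fun a => ‖g a i‖) l (𝓝 1))
    (hφg : ∀ i, Tendsto (fun a => ‖φ a i - g a i‖) l (𝓝 0)) :
    Tendsto (fun a => ∑ q, homogExtend f (sqrtMap hρ fun i => inner ℂ (b a q) (φ a i)) -
      ∑ q, homogExtend f (sqrtMap hρ fun i => inner ℂ (b a q) (g a i))) l (𝓝 0) := by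
  have : ProperSpace H := FiniteDimensional.proper ℂ H
  set p := hρ.isPositive.isSymmetric.eigenvalues rfl with hp
  have hφ : ∀ i, Tendsto (fun a => ‖φ a i‖) l (𝓝 1) := fun i =>
    tendsto_norm_of_tendsto_norm_sub (hφg i) (hg i)
  have hS : 0 ≤ ∑ i, p i := Finset.sum_nonneg fun i _ => eigenvalues_nonneg hρ i
  rw [Metric.tendsto_nhds]
  intro ε hε
  -- The error tends to `2 * η * ∑ pᵢ`; the `+ 1` in `η` makes this strictly less than `ε` and keeps
  -- the denominator positive. `C` does not depend on the index `a`.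
  obtain ⟨C, -, hC⟩ := exists_abs_homogExtend_sub_le f
    (η := ε / (2 * ∑ i, p i + 1)) (by positivity)
  set η := ε / (2 * ∑ i, p i + 1) with hη
  have hlim : Tendsto (fun a => η * (∑ i, p i * ‖φ a i‖ ^ 2 + ∑ i, p i * ‖g a i‖ ^ 2) +
      C * ∑ i, p i * ‖φ a i - g a i‖ ^ 2) l (𝓝 (η * (∑ i, p i + ∑ i, p i))) := by
    have h1 : Tendsto (fun a => ∑ i, p i * ‖φ a i‖ ^ 2) l (𝓝 (∑ i, p i)) := by
      simpa using tendsto_finsetSum Finset.univ fun i _ => ((hφ i).pow 2).const_mul (p i)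
    have h2 : Tendsto (fun a => ∑ i, p i * ‖g a i‖ ^ 2) l (𝓝 (∑ i, p i)) := by
      simpa using tendsto_finsetSum Finset.univ fun i _ => ((hg i).pow 2).const_mul (p i)
    have h3 : Tendsto (fun a => ∑ i, p i * ‖φ a i - g a i‖ ^ 2) l (𝓝 0) := by
      simpa using tendsto_finsetSum Finset.univ fun i _ => ((hφg i).pow 2).const_mul (p i)
    simpa using ((h1.add h2).const_mul η).add (h3.const_mul C)
  have hlt : η * (∑ i, p i + ∑ i, p i) < ε := by
    rw [hη, div_mul_eq_mul_div, div_lt_iff₀ (by positivity)]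
    exact mul_lt_mul_of_pos_left (by linarith) hε
  filter_upwards [hlim.eventually_lt_const hlt] with a ha
  rw [Real.dist_eq, sub_zero]
  refine lt_of_le_of_lt ?_ ha
  rw [← Finset.sum_sub_distrib, hp, ← sum_norm_sq_sqrtMap_inner hρ (b a),
    ← sum_norm_sq_sqrtMap_inner hρ (b a), ← sum_norm_sq_sqrtMap_inner hρ (b a),
    ← Finset.sum_add_distrib, Finset.mul_sum, Finset.mul_sum, ← Finset.sum_add_distrib]
  refine (Finset.abs_sum_le_sum_abs _ _).trans (Finset.sum_le_sum fun q _ => ?_)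
  refine (hC _ _).trans (le_of_eq ?_)
  rw [← sqrtMap_sub]
  simp_rw [inner_sub_right]
  rfl

end Comparison

/-! ### Gaussian sequences, the strong law, and Gaussian families -/

section GaussianFamily

variable {κ : Type*} [Fintype κ]

/-- The law of a sequence of independent standard complex Gaussian vectors in `ℂ^κ`. -/
noncomputable def gaussianSequence (κ : Type*) [Fintype κ] : Measure (ℕ → κ → ℂ) :=
  Measure.infinitePi fun _ => Measure.pi fun _ => complexGaussian 1

instance isProbabilityMeasure_gaussianSequence : IsProbabilityMeasure (gaussianSequence κ) :=
  inferInstanceAs (IsProbabilityMeasure (Measure.infinitePi _))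

theorem ae_tendsto_average_gaussianSequence {F : Type*} [NormedAddCommGroup F] [NormedSpace ℝ F]
    [CompleteSpace F] [MeasurableSpace F] [BorelSpace F] {X : (κ → ℂ) → F} (hX : Measurable X)
    (hint : Integrable X (Measure.pi fun _ => complexGaussian 1)) :
    ∀ᵐ ω ∂(gaussianSequence κ), Tendsto
      (fun n : ℕ => (n : ℝ)⁻¹ • ∑ q ∈ Finset.range n, X (ω q)) atTop
      (𝓝 (∫ z, X z ∂(Measure.pi fun _ => complexGaussian 1))) := by
  have hmp : ∀ q : ℕ, MeasurePreserving (fun ω : ℕ → κ → ℂ => ω q) (gaussianSequence κ)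
      (Measure.pi fun _ => complexGaussian 1) := fun q =>
    measurePreserving_eval_infinitePi (fun _ : ℕ => Measure.pi fun _ : κ => complexGaussian 1) q
  have hid : ∀ q : ℕ, (gaussianSequence κ).map (fun ω => X (ω q)) =
      (Measure.pi fun _ => complexGaussian 1).map X := fun q => by
    rw [← (hmp q).map_eq, Measure.map_map hX (measurable_pi_apply q)]
    rfl
  have h := strong_law_ae (μ := gaussianSequence κ) (fun q ω => X (ω q))
    ((hmp 0).integrable_comp_of_integrable hint)
    (fun i j hij => (iIndepFun_infinitePi (P := fun _ : ℕ => Measure.pi fun _ : κ =>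
      complexGaussian 1) (X := fun _ => X) fun _ => hX).indepFun hij)
    (fun q => ⟨(hX.comp (measurable_pi_apply q)).aemeasurable,
      (hX.comp (measurable_pi_apply 0)).aemeasurable, (hid q).trans (hid 0).symm⟩)
  have hm : ∫ ω, X (ω 0) ∂(gaussianSequence κ) =
      ∫ z, X z ∂(Measure.pi fun _ => complexGaussian 1) := by
    rw [← (hmp 0).map_eq, integral_map (measurable_pi_apply 0).aemeasurable]
    rw [(hmp 0).map_eq]
    exact hint.aestronglyMeasurable
  rwa [hm] at h

variable {E : Type*} [NormedAddCommGroup E] [InnerProductSpace ℂ E] {ι : Type*} [Fintype ι]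

/-- The vectors whose coordinates in the basis `b` are the first terms of the sequence `ω`,
normalized to have length about `1`. -/
noncomputable def gaussianFamily (b : OrthonormalBasis ι ℂ E) (ω : ℕ → κ → ℂ) (i : κ) : E :=
  (((√(Fintype.card ι))⁻¹ : ℝ) : ℂ) • ∑ q, ω (Fintype.equivFin ι q) i • b q

omit [Fintype κ] in
theorem inner_gaussianFamily (b : OrthonormalBasis ι ℂ E) (ω : ℕ → κ → ℂ) (i : κ) (q : ι) :
    inner ℂ (b q) (gaussianFamily b ω i) =
      (((√(Fintype.card ι))⁻¹ : ℝ) : ℂ) * ω (Fintype.equivFin ι q) i := by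
  rw [gaussianFamily, inner_smul_right, b.orthonormal.inner_right_fintype]

theorem sum_equivFin {M : Type*} [AddCommMonoid M] (h : ℕ → M) :
    ∑ q : ι, h (Fintype.equivFin ι q) = ∑ q ∈ Finset.range (Fintype.card ι), h q := by
  rw [Finset.sum_range, ← Equiv.sum_comp (Fintype.equivFin ι)]

-- The Gram matrix is an empirical mean of `conj zᵢ * zⱼ`, so the strong law drives it to the
-- identity.
omit [Fintype κ] in
theorem inner_gaussianFamily_gaussianFamily (b : OrthonormalBasis ι ℂ E) (ω : ℕ → κ → ℂ)
    (i j : κ) : inner ℂ (gaussianFamily b ω i) (gaussianFamily b ω j) =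
      ((Fintype.card ι : ℝ)⁻¹) • ∑ q ∈ Finset.range (Fintype.card ι),
        (starRingEnd ℂ (ω q i) * ω q j) := by
  rw [← b.sum_inner_mul_inner, ← sum_equivFin (ι := ι) fun q => starRingEnd ℂ (ω q i) * ω q j,
    Finset.smul_sum]
  refine Finset.sum_congr rfl fun q _ => ?_
  rw [← inner_conj_symm, inner_gaussianFamily, inner_gaussianFamily, map_mul, Complex.conj_ofReal,
    Complex.real_smul]
  have h : (((√(Fintype.card ι))⁻¹ : ℝ) : ℂ) * (((√(Fintype.card ι))⁻¹ : ℝ) : ℂ) =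
      ((Fintype.card ι : ℝ)⁻¹ : ℝ) := by
    rw [← Complex.ofReal_mul, ← mul_inv, Real.mul_self_sqrt (Nat.cast_nonneg _)]
  rw [← h]
  ring

theorem sum_homogExtend_gaussianFamily {H : Type*} [NormedAddCommGroup H] [InnerProductSpace ℂ H]
    [FiniteDimensional ℂ H] {ρ : H →ₗ[ℂ] H} (hρ : IsDensityMatrix ρ) (f : UnitSphere H →ᵇ ℝ)
    (b : OrthonormalBasis ι ℂ E) (ω : ℕ → Fin (Module.finrank ℂ H) → ℂ) :
    ∑ q, homogExtend f (sqrtMap hρ fun i => inner ℂ (b q) (gaussianFamily b ω i)) =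
      (Fintype.card ι : ℝ)⁻¹ • ∑ q ∈ Finset.range (Fintype.card ι),
        homogExtend f (sqrtMap hρ (ω q)) := by
  rw [← sum_equivFin (ι := ι) fun q => homogExtend f (sqrtMap hρ (ω q)), Finset.smul_sum]
  refine Finset.sum_congr rfl fun q _ => ?_
  simp_rw [inner_gaussianFamily]
  rw [sqrtMap_smul, homogExtend_smul f (by positivity), inv_pow,
    Real.sq_sqrt (Nat.cast_nonneg _), smul_eq_mul]

variable [FiniteDimensional ℂ E] [MeasurableSpace E] [BorelSpace E]

omit [Fintype κ] in
theorem measurable_gaussianFamily (b : OrthonormalBasis ι ℂ E) :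
    Measurable (gaussianFamily (κ := κ) b) := by
  have : ProperSpace E := FiniteDimensional.proper ℂ E
  unfold gaussianFamily
  fun_prop

/-- Only finitely many terms of `ω`, at distinct indices, enter the family, so their joint law is a
finite product; the scalar normalization commutes with `V`. -/
theorem map_gaussianFamily_invariant (b : OrthonormalBasis ι ℂ E) (V : E ≃ₗᵢ[ℂ] E) :
    ((gaussianSequence κ).map (gaussianFamily b)).map (fun x i => V (x i)) =
      (gaussianSequence κ).map (gaussianFamily b) := by
  have : ProperSpace E := FiniteDimensional.proper ℂ E
  have hV : Measurable fun (x : κ → E) i => V (x i) :=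
    measurable_pi_lambda _ fun i => V.continuous.measurable.comp (measurable_pi_apply i)
  have hc : Measurable fun (x : κ → E) i => (((√(Fintype.card ι))⁻¹ : ℝ) : ℂ) • x i := by
    fun_prop
  have hT : Measurable fun (a : ι → κ → ℂ) (i : κ) => ∑ q, a q i • b q := by fun_prop
  have hr : Measurable fun (ω : ℕ → κ → ℂ) (q : ι) => ω (Fintype.equivFin ι q) := by fun_prop
  have hr' : (gaussianSequence κ).map (fun ω (q : ι) => ω (Fintype.equivFin ι q)) =
      Measure.pi fun _ : ι => Measure.pi fun _ : κ => complexGaussian 1 := by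
    rw [gaussianSequence, Measure.map_infinitePi_infinitePi_of_inj
      (f := fun q : ι => (Fintype.equivFin ι q : ℕ))
      (Fin.val_injective.comp (Fintype.equivFin ι).injective), Measure.infinitePi_eq_pi]
  have h : (gaussianSequence κ).map (gaussianFamily b) =
      ((Measure.pi fun _ : ι => Measure.pi fun _ : κ => complexGaussian 1).map
        (fun a i => ∑ q, a q i • b q)).map
        fun x i => (((√(Fintype.card ι))⁻¹ : ℝ) : ℂ) • x i := by
    rw [← hr', Measure.map_map hT hr, Measure.map_map hc (hT.comp hr)]
    rfl
  rw [h]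
  conv_rhs => rw [← map_gaussianFamily_map b V]
  rw [Measure.map_map hV hc, Measure.map_map hc hV]
  congr 1
  funext x i
  exact map_smul V _ _

end GaussianFamily

/-- The sum over the conditional vectors of the orthonormalized Gaussian family converges almost
surely to the integral with respect to `GAP(ρ)`. -/
theorem ae_tendsto_sum_homogExtend {H : Type*} [NormedAddCommGroup H] [InnerProductSpace ℂ H]
    [FiniteDimensional ℂ H] [MeasurableSpace H] [BorelSpace H] {ρ : H →ₗ[ℂ] H}
    (hρ : IsDensityMatrix ρ) (f : UnitSphere H →ᵇ ℝ) {E : ℕ → Type*}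
    [∀ n, NormedAddCommGroup (E n)] [∀ n, InnerProductSpace ℂ (E n)] {ι : ℕ → Type*}
    [∀ n, Fintype (ι n)] (hι : Tendsto (fun n => Fintype.card (ι n)) atTop atTop)
    (b : ∀ n, OrthonormalBasis (ι n) ℂ (E n)) :
    ∀ᵐ ω ∂(gaussianSequence (Fin (Module.finrank ℂ H))),
      (∀ᶠ n in atTop, Orthonormal ℂ (gramSchmidtNormed ℂ (gaussianFamily (b n) ω))) ∧
      Tendsto (fun n => ∑ q, homogExtend f (sqrtMap hρ fun i =>
        inner ℂ (b n q) (gramSchmidtNormed ℂ (gaussianFamily (b n) ω) i))) atTop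
        (𝓝 (∫ x, f x ∂(gap hρ))) := by
  have hconj : ∀ i j : Fin (Module.finrank ℂ H), Measurable
      fun z : Fin (Module.finrank ℂ H) → ℂ => starRingEnd ℂ (z i) * z j := fun i j =>
    ((Complex.continuous_conj.comp (continuous_apply i)).mul (continuous_apply j)).measurable
  have hlaw := fun i j => ae_tendsto_average_gaussianSequence (hconj i j)
    (integrable_conj_eval_mul_eval i j)
  have hF := ae_tendsto_average_gaussianSequence
    ((continuous_homogExtend f).comp (continuous_sqrtMap hρ)).measurable
    (integrable_homogExtend_sqrtMap hρ f)
  -- Finitely many pairs `i`, `j` and one further function: a single null set is discarded, and the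
  -- rest is deterministic in `ω`.
  filter_upwards [ae_all_iff.mpr fun i => ae_all_iff.mpr (hlaw i), hF] with ω h1 h2
  have hg : ∀ i, Tendsto (fun n => inner ℂ (gaussianFamily (b n) ω i)
      (gaussianFamily (b n) ω i)) atTop (𝓝 1) := fun i => by
    simp_rw [inner_gaussianFamily_gaussianFamily]
    have h := (h1 i i).comp hι
    rwa [integral_conj_eval_mul_self] at h
  have hg' : ∀ i j, i ≠ j → Tendsto (fun n => inner ℂ (gaussianFamily (b n) ω i)
      (gaussianFamily (b n) ω j)) atTop (𝓝 0) := fun i j hij => by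
    simp_rw [inner_gaussianFamily_gaussianFamily]
    have h := (h1 i j).comp hι
    rwa [integral_conj_eval_mul_of_ne hij] at h
  refine ⟨eventually_orthonormal_gramSchmidtNormed hg hg', ?_⟩
  have h3 := tendsto_sum_homogExtend_sub hρ f b (fun i => tendsto_norm_one_of_inner_self (hg i))
    (tendsto_gramSchmidtNormed_sub hg hg')
  have h4 : Tendsto (fun n => ∑ q, homogExtend f (sqrtMap hρ fun i =>
      inner ℂ (b n q) (gaussianFamily (b n) ω i))) atTop (𝓝 (∫ x, f x ∂(gap hρ))) := by
    simp_rw [sum_homogExtend_gaussianFamily]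
    rw [integral_gap]
    exact h2.comp hι
  simpa using h3.add h4

end GAPMeasure

/-! ### From almost sure convergence to convergence in probability -/

theorem mainTheorem4
    {H₁ : Type*} [NormedAddCommGroup H₁] [InnerProductSpace ℂ H₁] [FiniteDimensional ℂ H₁]
    [MeasurableSpace H₁] [BorelSpace H₁]
    {ρ₁ : H₁ →ₗ[ℂ] H₁} (hρ₁ : GAPMeasure.IsDensityMatrix ρ₁)
    (H₂ : ℕ → Type*) [∀ n, NormedAddCommGroup (H₂ n)] [∀ n, InnerProductSpace ℂ (H₂ n)]
    [∀ n, FiniteDimensional ℂ (H₂ n)] [∀ n, CompleteSpace (H₂ n)]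
    [∀ n, MeasurableSpace (H₂ n)] [∀ n, BorelSpace (H₂ n)]
    (hdim : ∀ n, Module.finrank ℂ H₁ ≤ Module.finrank ℂ (H₂ n))
    (hlim : Tendsto (fun n => Module.finrank ℂ (H₂ n)) atTop atTop)
    {ι : ℕ → Type*} [∀ n, Fintype (ι n)] (b : ∀ n, OrthonormalBasis (ι n) ℂ (H₂ n))
    (f : GAPMeasure.UnitSphere H₁ →ᵇ ℝ) (ε : ℝ) (hε : 0 < ε) :
    Tendsto
      (fun n => GAPMeasure.uniformWithReduced hρ₁ (hdim n)
        {ψ : H₁ ⊗[ℂ] H₂ n | ψ ∈ GAPMeasure.withReduced ρ₁ ∧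
          |∫ x, f x ∂(GAPMeasure.conditionalLaw (b n) ψ) - ∫ x, f x ∂(GAPMeasure.gap hρ₁)| < ε})
      atTop (𝓝 1) := by
  open GAPMeasure InnerProductSpace in
  have hproper : ∀ n, ProperSpace (H₂ n) := fun n => FiniteDimensional.proper ℂ _
  have hι : Tendsto (fun n => Fintype.card (ι n)) atTop atTop :=
    hlim.congr fun n => Module.finrank_eq_card_basis (b n).toBasis
  let S : ∀ n, Set (Fin (Module.finrank ℂ H₁) → H₂ n) := fun n =>
    {φ | Orthonormal ℂ φ ∧ |∑ q, homogExtend f (sqrtMap hρ₁ fun i => inner ℂ (b n q) (φ i)) -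
      ∫ x, f x ∂(gap hρ₁)| < ε}
  have hS : ∀ n, MeasurableSet (S n) := fun n => by
    refine MeasurableSet.inter ?_ ?_
    · have h : {φ : Fin (Module.finrank ℂ H₁) → H₂ n | Orthonormal ℂ φ} =
          ⋂ i, ⋂ j, {φ | inner ℂ (φ i) (φ j) = if i = j then (1 : ℂ) else 0} := by
        ext φ
        simp [orthonormal_iff_ite]
      change MeasurableSet {φ : Fin (Module.finrank ℂ H₁) → H₂ n | Orthonormal ℂ φ}
      rw [h]
      refine IsClosed.measurableSet (isClosed_iInter fun i => isClosed_iInter fun j => ?_)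
      exact isClosed_eq ((continuous_apply i).inner (continuous_apply j)) continuous_const
    · have hc : Continuous fun φ : Fin (Module.finrank ℂ H₁) → H₂ n =>
          |∑ q, homogExtend f (sqrtMap hρ₁ fun i => inner ℂ (b n q) (φ i)) -
            ∫ x, f x ∂(gap hρ₁)| := by
        refine ((continuous_finsetSum _ fun q _ => ?_).sub continuous_const).abs
        refine (continuous_homogExtend f).comp ((continuous_sqrtMap hρ₁).comp ?_)
        exact continuous_pi fun i => continuous_const.inner (continuous_apply i)
      exact (isOpen_lt hc continuous_const).measurableSet
  have hgs : ∀ n, Measurable fun ω : ℕ → Fin (Module.finrank ℂ H₁) → ℂ =>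
      gramSchmidtNormed ℂ (gaussianFamily (b n) ω) := fun n =>
    measurable_gramSchmidtNormed.comp (measurable_gaussianFamily (b n))
  have hone : Tendsto (fun n => gaussianSequence (Fin (Module.finrank ℂ H₁))
      {ω | gramSchmidtNormed ℂ (gaussianFamily (b n) ω) ∈ S n}) atTop (𝓝 1) := by
    -- Almost every `ω` lies in the event for all large `n`, so the indicators converge to 1 almost
    -- surely, and hence so do the probabilities.
    have h := tendsto_measure_of_ae_tendsto_indicator_of_isFiniteMeasure atTop
      (μ := gaussianSequence (Fin (Module.finrank ℂ H₁))) MeasurableSet.univ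
      (fun n => hgs n (hS n)) ?_
    · rw [measure_univ] at h
      exact h
    · filter_upwards [ae_tendsto_sum_homogExtend hρ₁ f hι b] with ω hω
      filter_upwards [hω.1, (Metric.tendsto_nhds.mp hω.2) ε hε] with n h1 h2
      exact iff_of_true ⟨h1, h2⟩ trivial
  refine tendsto_of_tendsto_of_tendsto_of_le_of_le hone tendsto_const_nhds (fun n => ?_)
    fun n => ?_
  · have : IsProbabilityMeasure ((gaussianSequence (Fin (Module.finrank ℂ H₁))).map
        (gaussianFamily (b n))) :=
      Measure.isProbabilityMeasure_map (measurable_gaussianFamily (b n)).aemeasurable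
    have h1 := measure_gramSchmidtNormed_le_uniformONS (hdim n)
      ((gaussianSequence (Fin (Module.finrank ℂ H₁))).map (gaussianFamily (b n)))
      (map_gaussianFamily_invariant (b n)) (hS n) fun x hx => hx.1
    have h2 := Measure.map_apply (μ := gaussianSequence (Fin (Module.finrank ℂ H₁)))
      (measurable_gaussianFamily (b n)) (measurable_gramSchmidtNormed (hS n))
    -- A lower bound suffices, as probabilities are at most 1. `Measure.le_map_apply` gives it
    -- without measurability of the event in `H₁ ⊗ H₂`.
    refine (h2.symm.le.trans h1).trans ((measure_mono fun φ hφ => ?_).trans (Measure.le_map_apply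
      (continuous_purification hρ₁).measurable.aemeasurable _))
    refine ⟨purification_mem_withReduced hρ₁ hφ.1, ?_⟩
    rw [integral_conditionalLaw]
    simp_rw [partialInner_purification]
    exact hφ.2
  · have h1 : IsProbabilityMeasure (uniformONS (H₂ := H₂ n) (hdim n)) :=
      Measure.isProbabilityMeasure_map (measurable_unitary_frame (hdim n)).aemeasurable
    have h2 : IsProbabilityMeasure (uniformWithReduced (H₂ := H₂ n) hρ₁ (hdim n)) :=
      Measure.isProbabilityMeasure_map (continuous_purification hρ₁).measurable.aemeasurable
    exact prob_le_one
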